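/- Let $H$ be a real separable Hilbert space and let $X=\{X_n,\ n\in\mathbb Z\}$ be a zero-mean ARH(1) process on a probability space $(\Omega,\mathcal A,P)$, i.e. a stationary $H$-valued process with finite second moments satisfying $X_n=\rho(X_{n-1})+\varepsilon_n$ a.s. for all $n\in\mathbb Z$, where $\rho$ is a bounded linear operator on $H$ with $\|\rho\|_{\mathcal L(H)}<1$ and $\{\varepsilon_n\}$ is a strong white noise (independent, identically distributed, zero-mean $H$-valued random variables with $E\|\varepsilon_n\|_H^2<\infty$). Write $(u\otimes v)(x)=\langle u,x\rangle_H v$, let $C_X=E[X_0\otimes X_0]$ be the autocovariance operator and, for $n\ge2$, let $C_n=\frac1n\sum_{i=0}^{n-1}X_i\otimes X_i$ be the empirical autocovariance operator. Let $C_1\ge C_2\ge\cdots\geq 0$ be the eigenvalues of $C_X$, with orthonormal eigenvectors $\{\phi_j,\ j\ge1\}$, $C_X\phi_j=C_j\phi_j$, and let $C_{n,1}\ge C_{n,2}\ge\cdots\ge0$ be the (random) eigenvalues of $C_n$, with orthonormal (random) eigenvectors $\{\phi_{n,j},\ j\ge1\}$, $C_n\phi_{n,j}=C_{n,j}\phi_{n,j}$;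 both lists are indexed by $j\ge 1$, repeated according to multiplicity, and exhaust the operator in the sense that $C_X$ (respectively $C_n$) vanishes on the orthogonal complement of the listed eigenvectors. Put $$\phi'_{n,j}=\operatorname{sgn}\langle\phi_{n,j},\phi_j\rangle_H\,\phi_j,\qquad \operatorname{sgn} t=\mathbf 1_{t\ge0}-\mathbf 1_{t<0},\qquad \Lambda_k=\sup_{1\le j\le k}(C_j-C_{j+1})^{-1},$$ with $\Lambda_k=+\infty$ if $C_j=C_{j+1}$ for some $j\le k$. Let $k_n$, $n\geq 2$, be positive integers with $k_n\to\infty$ and $k_n/n<1$. Suppose that $\|X_0\|_H$ is almost surely bounded by a constant, that $E\|X_0\|_H^4<\infty$, and that, for some $\beta>1/2$, $$\Lambda_{k_n}=o\left(n^{1/4}(\ln n)^{\beta-1/2}\right),\quad n\to\infty.$$ Then, for this $\beta$, $$\frac{n^{1/4}}{(\ln n)^\beta}\sup_{1\le j\le k_n}\|\phi'_{n,j}-\phi_{n,j}\|_H\to0\quad\text{almost surely, as } n\to\infty .$$ -/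

import Mathlib

open MeasureTheory ProbabilityTheory Filter Topology
open scoped ENNReal

namespace ARH

section Definitions

variable {Ω H : Type*} [NormedAddCommGroup H] [InnerProductSpace ℝ H]

/-- The rank-one operator `u ⊗ v : x ↦ ⟨u, x⟩ v` on a real Hilbert space. -/
noncomputable def tensor (u v : H) : H →L[ℝ] H :=
  InnerProductSpace.rankOne ℝ v u

/-- The (uncentred) cross-covariance operator `E[U ⊗ V]`, as a Bochner integral in the space of
bounded operators. For centred `U` it is the covariance operator of `U` when `V = U`. -/
noncomputable def covOp [MeasurableSpace Ω] (P : Measure Ω) (U V : Ω → H) : H →L[ℝ] H :=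
  ∫ ω, tensor (U ω) (V ω) ∂P

/-- Strong white noise: independent, identically distributed, centred `H`-valued random variables
with finite second moment. -/
structure IsStrongWhiteNoise [MeasurableSpace Ω] [MeasurableSpace H]
    (P : Measure Ω) (ε : ℤ → Ω → H) : Prop where
  measurable : ∀ n, Measurable (ε n)
  iIndep : iIndepFun ε P
  identDistrib : ∀ n, IdentDistrib (ε n) (ε 0) P P
  memLp : ∀ n, MemLp (ε n) 2 P
  mean_zero : ∀ n, ∫ ω, ε n ω ∂P = 0

/-- Centred (second order) stationary `H`-valued process: finite second moments, zero mean, and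
shift-invariant cross-covariance operators. -/
structure IsCentredStationary [MeasurableSpace Ω] [MeasurableSpace H]
    (P : Measure Ω) (X : ℤ → Ω → H) : Prop where
  measurable : ∀ n, Measurable (X n)
  memLp : ∀ n, MemLp (X n) 2 P
  mean_zero : ∀ n, ∫ ω, X n ω ∂P = 0
  cov_shift : ∀ n m h, covOp P (X (n + h)) (X (m + h)) = covOp P (X n) (X m)

/-- `X` is a zero-mean autoregressive Hilbertian process of order one with autocorrelation
operator `ρ`, `‖ρ‖ < 1`, and innovations `ε`: a stationary solution of
`X n = ρ (X (n - 1)) + ε n` (a.s.), for all integers `n`, where `ε` is a strong white noise. -/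
structure IsARH1 [MeasurableSpace Ω] [MeasurableSpace H]
    (P : Measure Ω) (ρ : H →L[ℝ] H) (ε X : ℤ → Ω → H) : Prop where
  norm_lt_one : ‖ρ‖ < 1
  noise : IsStrongWhiteNoise P ε
  stationary : IsCentredStationary P X
  eqn : ∀ n, ∀ᵐ ω ∂P, X n ω = ρ (X (n - 1) ω) + ε n ω

/-- The autocovariance operator `C_X = E[X₀ ⊗ X₀]`. -/
noncomputable def autocov [MeasurableSpace Ω] (P : Measure Ω) (X : ℤ → Ω → H) : H →L[ℝ] H :=
  covOp P (X 0) (X 0)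

/-- The empirical autocovariance operator `C_n = n⁻¹ ∑_{i<n} X_i ⊗ X_i` at the outcome `ω`. -/
noncomputable def empCov (X : ℤ → Ω → H) (n : ℕ) (ω : Ω) : H →L[ℝ] H :=
  (n : ℝ)⁻¹ • ∑ i ∈ Finset.range n, tensor (X (i : ℤ) ω) (X (i : ℤ) ω)

/-- `(c, e)` is a system of eigenvalues and eigenvectors of the (positive, compact) operator `T`:
the `e j` are orthonormal eigenvectors, the eigenvalues `c j` are arranged in non-increasing order,
and the list is exhaustive (repeated according to multiplicity) except possibly for part of the
kernel. Indices start at `0`: `c j`, `e j` is the `(j+1)`-st pair. -/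
structure IsEigensystem (T : H →L[ℝ] H) (c : ℕ → ℝ) (e : ℕ → H) : Prop where
  orthonormal : Orthonormal ℝ e
  eigen : ∀ j, T (e j) = c j • e j
  antitone : Antitone c
  exhaustive : ∀ x, (∀ j, inner ℝ (e j) x = 0) → T x = 0

/-- `Λ_k`, the supremum of `(c_j - c_{j+1})⁻¹` over the first `k` indices, with values in `[0, ∞]`:
it is `∞` when two consecutive eigenvalues among the first `k + 1` coincide. -/
noncomputable def invGap (c : ℕ → ℝ) (k : ℕ) : ℝ≥0∞ :=
  ⨆ j : Fin k, (ENNReal.ofReal (c j - c (j + 1)))⁻¹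

/-- The sign-adjusted vector `sgn⟨v, e⟩ e`, with `sgn t = 1` for `t ≥ 0` and `-1` for `t < 0`. -/
noncomputable def signAdjust (v e : H) : H :=
  (if 0 ≤ (inner ℝ v e : ℝ) then (1 : ℝ) else -1) • e

end Definitions

end ARH

/-! The eigenvectors are controlled by the operators. If `g` is a lower bound for the first `j + 1`
consecutive eigenvalue gaps of `C_X`, a Davis–Kahan argument gives `‖φ'_{n,j} - φ_{n,j}‖ ≤ 4 ‖C_n -
C_X‖ / g` (`IsEigensystem.norm_signAdjust_sub_le`); taking `1 / g = Λ_{k_n}` makes the bound uniform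
over the first `k_n` indices. It then suffices that almost surely `‖C_n - C_X‖ = O(√(ln n / n))`
(`IsARH1.ae_eventually_norm_empCov_sub_le`): multiplying by `n^{1/4} / (ln n)^β` leaves `Λ_{k_n} /
(n^{1/4} (ln n)^{β - 1/2})`, which tends to zero by hypothesis.

The rate is a concentration statement for `∑ f (X_k)`, with `f` bounded, Lipschitz and
Hilbert-valued. Boundedness of `X_0` forces the innovations to be bounded. As `‖ρ‖ < 1`, the
influence of one innovation on the conditional expectation of the whole sum is bounded uniformly in
`n`, so the Doob martingale of the sum has bounded increments. An exponential inequality for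
Hilbert-valued martingales (`lintegral_exp_sum_le`), Markov's inequality and Borel–Cantelli give the
order `√(n ln n)`. For the covariance, `f x` is `x ⊗ x` in the completed Hilbert tensor square,
whose norm dominates the operator norm; a truncation makes it globally bounded and Lipschitz. -/

namespace ARH

/-! ### Perturbation of eigenvalues and eigenvectors of positive operators. -/

section Spectral

variable {H : Type*} [NormedAddCommGroup H] [InnerProductSpace ℝ H]

theorem IsEigensystem.eigenvalue_nonneg {T : H →L[ℝ] H} {c : ℕ → ℝ} {e : ℕ → H}
    (h : IsEigensystem T c e) (hT : ∀ x, 0 ≤ inner ℝ (T x) x) (j : ℕ) : 0 ≤ c j := by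
  have := hT (e j)
  rwa [h.eigen, real_inner_smul_left, real_inner_self_eq_norm_sq, h.orthonormal.1 j, one_pow,
    mul_one] at this

/-- The listed vectors need not form a basis, but `x` minus its projection `p` onto their closed
span is orthogonal to all of them and so is killed by `T`. Hence `T x = T p`, and `T` can be applied
termwise. -/
theorem IsEigensystem.hasSum_inner [CompleteSpace H] {T : H →L[ℝ] H} {c : ℕ → ℝ} {e : ℕ → H}
    (h : IsEigensystem T c e) (x : H) :
    HasSum (fun i => c i * inner ℝ (e i) x ^ 2) (inner ℝ (T x) x) := by
  have hs : Summable fun i => (inner ℝ (e i) x : ℝ) • e i := by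
    have := (h.orthonormal.orthogonalFamily.summable_iff_norm_sq_summable
      (fun i => (inner ℝ (e i) x : ℝ))).2 (h.orthonormal.inner_products_summable x)
    simpa using this
  set p := ∑' i, (inner ℝ (e i) x : ℝ) • e i with hp
  have hsum : HasSum (fun i => (inner ℝ (e i) x : ℝ) • e i) p := hs.hasSum
  have hperp : ∀ j, inner ℝ (e j) (x - p) = (0 : ℝ) := by
    intro j
    have h1 : HasSum (fun i => inner ℝ (e j) ((inner ℝ (e i) x : ℝ) • e i)) (inner ℝ (e j) p) :=
      hsum.mapL (innerSL ℝ (e j))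
    have h2 : HasSum (fun i => inner ℝ (e j) ((inner ℝ (e i) x : ℝ) • e i)) (inner ℝ (e j) x) := by
      convert hasSum_ite_eq j (inner ℝ (e j) x : ℝ) using 2 with i
      rw [real_inner_smul_right, orthonormal_iff_ite.1 h.orthonormal j i]
      by_cases hij : i = j
      · simp [hij]
      · simp [hij, Ne.symm hij]
    rw [inner_sub_right, h1.unique h2, sub_self]
  have hTx : T x = T p := by
    rw [← sub_eq_zero, ← map_sub, h.exhaustive _ hperp]
  have h3 : HasSum (fun i => T ((inner ℝ (e i) x : ℝ) • e i)) (T x) := by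
    rw [hTx]; exact hsum.mapL T
  have h4 : HasSum (fun i => inner ℝ x (T ((inner ℝ (e i) x : ℝ) • e i))) (inner ℝ x (T x)) :=
    h3.mapL (innerSL ℝ x)
  rw [real_inner_comm]
  convert h4 using 2 with i
  rw [map_smul, h.eigen, real_inner_smul_right, real_inner_smul_right, real_inner_comm x (e i)]
  ring

/-- Upper Rayleigh bound on the orthogonal complement of the leading eigenvectors. -/
theorem IsEigensystem.inner_le [CompleteSpace H] {T : H →L[ℝ] H} {c : ℕ → ℝ} {e : ℕ → H}
    (h : IsEigensystem T c e) (hT : ∀ x, 0 ≤ inner ℝ (T x) x) {j : ℕ} {x : H}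
    (hx : ∀ i < j, inner ℝ (e i) x = (0 : ℝ)) : inner ℝ (T x) x ≤ c j * ‖x‖ ^ 2 := by
  have hs := h.orthonormal.inner_products_summable x
  have hb := h.orthonormal.tsum_inner_products_le x
  simp only [Real.norm_eq_abs, sq_abs] at hs hb
  calc inner ℝ (T x) x ≤ c j * ∑' i, inner ℝ (e i) x ^ 2 := by
        refine hasSum_le (fun i => ?_) (h.hasSum_inner x) (hs.hasSum.mul_left (c j))
        rcases lt_or_ge i j with hij | hij
        · simp [hx i hij]
        · exact mul_le_mul_of_nonneg_right (h.antitone hij) (sq_nonneg _)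
    _ ≤ c j * ‖x‖ ^ 2 := mul_le_mul_of_nonneg_left hb (h.eigenvalue_nonneg hT j)

/-- Lower Rayleigh bound on the span of the leading eigenvectors. -/
theorem IsEigensystem.le_inner_sum {T : H →L[ℝ] H} {c : ℕ → ℝ} {e : ℕ → H}
    (h : IsEigensystem T c e) {m : ℕ} {b : ℝ} (hb : ∀ i < m, b ≤ c i) (a : ℕ → ℝ) :
    b * ‖∑ i ∈ Finset.range m, a i • e i‖ ^ 2 ≤
      inner ℝ (T (∑ i ∈ Finset.range m, a i • e i)) (∑ i ∈ Finset.range m, a i • e i) := by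
  have h1 : T (∑ i ∈ Finset.range m, a i • e i) = ∑ i ∈ Finset.range m, (a i * c i) • e i := by
    simp [map_sum, h.eigen, smul_smul]
  rw [h1, ← real_inner_self_eq_norm_sq, h.orthonormal.inner_sum, h.orthonormal.inner_sum,
    Finset.mul_sum]
  refine Finset.sum_le_sum fun i hi => ?_
  have := mul_le_mul_of_nonneg_right (hb i (Finset.mem_range.1 hi)) (mul_self_nonneg (a i))
  simp only [conj_trivial]
  linarith

/-- Dimension count behind the min-max principle: `j` linear conditions on a `(j + 1)`-dimensional
span have a nonzero solution. -/
theorem exists_sum_ne_zero_orthogonal {e : ℕ → H} (he : Orthonormal ℝ e) (f : ℕ → H) (j : ℕ) :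
    ∃ a : ℕ → ℝ, ∑ i ∈ Finset.range (j + 1), a i • e i ≠ 0 ∧
      ∀ l < j, inner ℝ (f l) (∑ i ∈ Finset.range (j + 1), a i • e i) = (0 : ℝ) := by
  let L : (Fin (j + 1) → ℝ) →ₗ[ℝ] (Fin j → ℝ) :=
    LinearMap.pi fun l => (innerₗ H (f l)) ∘ₗ Fintype.linearCombination ℝ (fun i : Fin (j + 1) => e i)
  have hker : LinearMap.ker L ≠ ⊥ := LinearMap.ker_ne_bot_of_finrank_lt (by simp)
  obtain ⟨a, ha, ha0⟩ := (Submodule.ne_bot_iff _).1 hker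
  have hsum : ∑ i ∈ Finset.range (j + 1), (if hi : i < j + 1 then a ⟨i, hi⟩ else 0) • e i =
      ∑ i : Fin (j + 1), a i • e i := by
    rw [Finset.sum_range]
    exact Finset.sum_congr rfl fun i _ => by rw [dif_pos i.2]
  refine ⟨fun i => if hi : i < j + 1 then a ⟨i, hi⟩ else 0, ?_, fun l hl => ?_⟩
  · rw [hsum]
    intro h0
    apply ha0
    have := Fintype.linearIndependent_iff.1
      (he.comp (fun i : Fin (j + 1) => (i : ℕ)) Fin.val_injective).linearIndependent a h0
    exact funext this
  · rw [hsum]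
    have := congrFun (LinearMap.mem_ker.1 ha) ⟨l, hl⟩
    simpa [L, Fintype.linearCombination_apply, inner_sum, real_inner_smul_right] using this

theorem abs_inner_apply_self_le (S : H →L[ℝ] H) (x : H) : |inner ℝ (S x) x| ≤ ‖S‖ * ‖x‖ ^ 2 := by
  calc |inner ℝ (S x) x| ≤ ‖S x‖ * ‖x‖ := abs_real_inner_le_norm _ _
    _ ≤ ‖S‖ * ‖x‖ * ‖x‖ := by gcongr; exact S.le_opNorm x
    _ = _ := by ring

/-- One half of Weyl's inequality for the eigenvalues of positive operators. -/
theorem IsEigensystem.eigenvalue_le_add [CompleteSpace H] {T T' : H →L[ℝ] H} {c c' : ℕ → ℝ}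
    {e e' : ℕ → H} (h : IsEigensystem T c e) (h' : IsEigensystem T' c' e')
    (hT' : ∀ x, 0 ≤ inner ℝ (T' x) x) (j : ℕ) : c j ≤ c' j + ‖T - T'‖ := by
  -- This `x` lies in the span of the first `j + 1` eigenvectors of `T` and is orthogonal to the
  -- first `j` of `T'`, so its Rayleigh quotient is at least `c j` for `T` and at most `c' j` for
  -- `T'`.
  obtain ⟨a, hx0, hx⟩ := exists_sum_ne_zero_orthogonal h.orthonormal e' j
  have h1 := h.le_inner_sum (m := j + 1) (b := c j)
    (fun i hi => h.antitone (Nat.lt_succ_iff.1 hi)) a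
  set x := ∑ i ∈ Finset.range (j + 1), a i • e i
  have h2 := h'.inner_le hT' hx
  have h3 := le_of_abs_le (abs_inner_apply_self_le (T - T') x)
  rw [sub_apply, inner_sub_left] at h3
  have hpos : 0 < ‖x‖ ^ 2 := by positivity
  refine le_of_mul_le_mul_right ?_ hpos
  linarith

/-- **Weyl's inequality**. -/
theorem IsEigensystem.abs_eigenvalue_sub_le [CompleteSpace H] {T T' : H →L[ℝ] H} {c c' : ℕ → ℝ}
    {e e' : ℕ → H} (h : IsEigensystem T c e) (h' : IsEigensystem T' c' e')
    (hT : ∀ x, 0 ≤ inner ℝ (T x) x) (hT' : ∀ x, 0 ≤ inner ℝ (T' x) x) (j : ℕ) :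
    |c j - c' j| ≤ ‖T - T'‖ := by
  have h1 := h.eigenvalue_le_add h' hT' j
  have h2 := h'.eigenvalue_le_add h hT j
  rw [norm_sub_rev] at h2
  rw [abs_le]
  constructor <;> linarith

/-- `T - c j` is bounded below by the spectral gap on the orthogonal complement of `e j`. -/
theorem IsEigensystem.gap_mul_norm_le [CompleteSpace H] {T : H →L[ℝ] H} {c : ℕ → ℝ} {e : ℕ → H}
    (h : IsEigensystem T c e) (hT : ∀ x, 0 ≤ inner ℝ (T x) x)
    (hsymm : ∀ x y, inner ℝ (T x) y = (inner ℝ x (T y) : ℝ)) {j : ℕ} {g : ℝ}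
    (hg1 : ∀ i < j, c j + g ≤ c i) (hg2 : c (j + 1) + g ≤ c j) {w : H}
    (hw : inner ℝ (e j) w = (0 : ℝ)) : g * ‖w‖ ≤ ‖T w - c j • w‖ := by
  set a := ∑ i ∈ Finset.range j, (inner ℝ (e i) w : ℝ) • e i with ha
  set b := w - a with hb
  have hwab : w = a + b := by simp [hb]
  have hea : ∀ i, inner ℝ (e i) a = if i < j then (inner ℝ (e i) w : ℝ) else 0 := by
    intro i
    split_ifs with hi
    · exact h.orthonormal.inner_right_sum _ (Finset.mem_range.2 hi)
    · rw [ha, inner_sum]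
      refine Finset.sum_eq_zero fun l hl => ?_
      rw [real_inner_smul_right, h.orthonormal.2, mul_zero]
      rintro rfl
      exact hi (Finset.mem_range.1 hl)
  have heb : ∀ i < j + 1, inner ℝ (e i) b = (0 : ℝ) := by
    intro i hi
    rw [hb, inner_sub_right, hea]
    split_ifs with hij
    · simp
    · rw [show i = j by omega, hw, sub_zero]
  have hab : inner ℝ a b = (0 : ℝ) := by
    conv_lhs => rw [ha]
    rw [sum_inner]
    refine Finset.sum_eq_zero fun l hl => ?_
    rw [real_inner_smul_left, heb l (by have := Finset.mem_range.1 hl; omega), mul_zero]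
  have h1 := h.le_inner_sum hg1 (fun i => inner ℝ (e i) w)
  rw [← ha] at h1
  have h2 := h.inner_le hT heb
  have hba : inner ℝ b a = (0 : ℝ) := by rw [real_inner_comm, hab]
  have hn1 : ‖w‖ ^ 2 = ‖a‖ ^ 2 + ‖b‖ ^ 2 := by
    rw [hwab, norm_add_sq_real, hab]; ring
  have hn2 : ‖a - b‖ ^ 2 = ‖w‖ ^ 2 := by
    rw [hn1, norm_sub_sq_real, hab]; ring
  have hn3 : ‖a - b‖ = ‖w‖ := by
    rwa [sq_eq_sq₀ (norm_nonneg _) (norm_nonneg _)] at hn2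
  -- `T - c j` is at least `g` on the part `a` above the gap and at most `-g` on the part `b` below
  -- it. Testing against `a - b`, which has the same norm as `w`, makes both contributions positive.
  have key : g * ‖w‖ ^ 2 ≤ inner ℝ (T w - c j • w) (a - b) := by
    have : inner ℝ (T w - c j • w) (a - b) =
        inner ℝ (T a) a - c j * ‖a‖ ^ 2 - (inner ℝ (T b) b - c j * ‖b‖ ^ 2) := by
      rw [hwab, map_add]
      simp only [inner_sub_left, inner_add_left, inner_sub_right, real_inner_smul_left, smul_add,
        hab, hba, real_inner_self_eq_norm_sq]
      have : inner ℝ (T a) b = (inner ℝ (T b) a : ℝ) := by rw [hsymm, real_inner_comm]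
      linarith
    rw [this, hn1]
    nlinarith [mul_le_mul_of_nonneg_right hg2 (sq_nonneg ‖b‖)]
  have h3 := key.trans (real_inner_le_norm _ _)
  rw [hn3] at h3
  rcases (norm_nonneg w).eq_or_lt with h0 | h0
  · rw [← h0]; simp
  · refine le_of_mul_le_mul_right ?_ h0
    linarith

/-- Davis–Kahan type bound for the sign-adjusted eigenvectors. -/
theorem IsEigensystem.norm_signAdjust_sub_le [CompleteSpace H] {T T' : H →L[ℝ] H} {c c' : ℕ → ℝ}
    {e e' : ℕ → H} (h : IsEigensystem T c e) (h' : IsEigensystem T' c' e')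
    (hT : ∀ x, 0 ≤ inner ℝ (T x) x) (hT' : ∀ x, 0 ≤ inner ℝ (T' x) x)
    (hsymm : ∀ x y, inner ℝ (T x) y = (inner ℝ x (T y) : ℝ)) {j : ℕ} {g : ℝ} (hg : 0 < g)
    (hgap : ∀ i ≤ j, c (i + 1) + g ≤ c i) :
    ‖signAdjust (e' j) (e j) - e' j‖ ≤ 4 * ‖T' - T‖ / g := by
  have hg1 : ∀ i < j, c j + g ≤ c i := fun i hi =>
    (add_le_add_left (h.antitone (show i + 1 ≤ j from hi)) g).trans (hgap i hi.le)
  set t : ℝ := inner ℝ (e j) (e' j) with ht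
  have hej : ‖e j‖ = 1 := h.orthonormal.1 j
  have hej' : ‖e' j‖ = 1 := h'.orthonormal.1 j
  set w := e' j - t • e j with hw
  have hwp : inner ℝ (e j) w = (0 : ℝ) := by
    rw [hw, inner_sub_right, real_inner_smul_right, real_inner_self_eq_norm_sq, hej, ← ht]; simp
  have h1 := h.gap_mul_norm_le hT hsymm hg1 (hgap j le_rfl) hwp
  -- The component along `e j` is killed by `T - c j`, so only `e' j` matters, and it is an
  -- approximate eigenvector of `T` for `c j`: one `‖T - T'‖` comes from the operator, another from
  -- Weyl's inequality.
  have h2 : T w - c j • w = (T - T') (e' j) - (c j - c' j) • e' j := by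
    rw [hw, map_sub, map_smul, h.eigen, sub_apply, h'.eigen]
    module
  have h3 : ‖T w - c j • w‖ ≤ 2 * ‖T' - T‖ := by
    rw [h2]
    refine (norm_sub_le _ _).trans ?_
    have h4 := (T - T').le_opNorm (e' j)
    have h5 := h.abs_eigenvalue_sub_le h' hT hT' j
    rw [norm_smul, hej', Real.norm_eq_abs]
    rw [hej'] at h4
    rw [norm_sub_rev T' T]
    linarith
  have hw2 : ‖w‖ ^ 2 = 1 - t ^ 2 := by
    rw [hw, norm_sub_sq_real, real_inner_smul_right, norm_smul, hej, hej', Real.norm_eq_abs,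
      real_inner_comm, ← ht, mul_one, sq_abs]
    ring
  have ht1 : |t| ≤ 1 := by
    have := abs_real_inner_le_norm (e j) (e' j)
    rwa [hej, hej', mul_one] at this
  have hs : ‖signAdjust (e' j) (e j) - e' j‖ ^ 2 = 2 - 2 * |t| := by
    have h6 : signAdjust (e' j) (e j) = (if 0 ≤ t then (1 : ℝ) else -1) • e j := by
      rw [signAdjust, real_inner_comm]
    rw [h6, norm_sub_sq_real, real_inner_smul_left, norm_smul, hej, hej', ← ht]
    split_ifs with h0
    · rw [abs_of_nonneg h0]; norm_num; ring
    · rw [abs_of_neg (not_le.1 h0)]; norm_num; ring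
  -- Since `|t| ≤ 1`, `2 - 2|t| ≤ 4 (1 - t²)`.
  have hle : ‖signAdjust (e' j) (e j) - e' j‖ ≤ 2 * ‖w‖ := by
    refine le_of_sq_le_sq ?_ (by positivity)
    rw [hs, mul_pow, hw2, ← sq_abs t]
    nlinarith [abs_nonneg t]
  rw [le_div_iff₀ hg]
  nlinarith
end Spectral

/-! ### Exponential inequality for Hilbert-valued sums along an autoregression. -/

section Concentration

variable {K : Type*} [NormedAddCommGroup K] [InnerProductSpace ℝ K]

theorem sqrt_norm_sq_add_le {K : Type*} [NormedAddCommGroup K] (v w : K) {q : ℝ} (hq : 0 ≤ q) :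
    √(‖v + w‖ ^ 2 + q) ≤ √(‖v‖ ^ 2 + q) + ‖w‖ := by
  rw [Real.sqrt_le_left (by positivity)]
  have h1 : ‖v‖ ≤ √(‖v‖ ^ 2 + q) := Real.le_sqrt_of_sq_le (by linarith)
  have h2 : √(‖v‖ ^ 2 + q) ^ 2 = ‖v‖ ^ 2 + q := Real.sq_sqrt (by positivity)
  have h3 := norm_add_le v w
  have h4 : ‖v + w‖ ^ 2 ≤ (‖v‖ + ‖w‖) ^ 2 := by gcongr
  nlinarith [mul_le_mul_of_nonneg_right h1 (norm_nonneg w)]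

/-- Exponential moment of `√(‖v + ξ‖² + q)` for a bounded centred Hilbert-valued `ξ`. -/
theorem lintegral_exp_sqrt_le [CompleteSpace K] {E : Type*} [MeasurableSpace E] {ν : Measure E}
    [IsProbabilityMeasure ν] {ξ : E → K} (hm : AEStronglyMeasurable ξ ν) {c : ℝ} (hc : 0 ≤ c)
    (hb : ∀ᵐ e ∂ν, ‖ξ e‖ ≤ c) (h0 : ∫ e, ξ e ∂ν = 0) (v : K) {q : ℝ} (hq : 0 ≤ q) {t : ℝ}
    (ht : 0 ≤ t) :
    ∫⁻ e, ENNReal.ofReal (Real.exp (t * √(‖v + ξ e‖ ^ 2 + q))) ∂ν ≤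
      ENNReal.ofReal (Real.exp (t ^ 2 * c ^ 2 / 2)) *
        ENNReal.ofReal (Real.exp (t * √(‖v‖ ^ 2 + (c ^ 2 + q)))) := by
  set h : E → ℝ := fun e => √(‖v + ξ e‖ ^ 2 + q) with hh
  have hξ : Integrable ξ ν := Integrable.of_bound hm c hb
  have hhm : AEStronglyMeasurable h ν := by
    have hcont : Continuous fun x : K => √(‖v + x‖ ^ 2 + q) := by fun_prop
    exact hcont.comp_aestronglyMeasurable hm
  set a := √(‖v‖ ^ 2 + q) with ha
  -- The function `x ↦ √(‖x‖² + q)` is 1-Lipschitz, so `h` stays in an interval of length `2c` and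
  -- Hoeffding's lemma gives the factor `exp (t² c² / 2)` around its mean.
  have hI : ∀ᵐ e ∂ν, h e ∈ Set.Icc (a - c) (a + c) := by
    filter_upwards [hb] with e he
    have h1 := sqrt_norm_sq_add_le v (ξ e) hq
    have h2 := sqrt_norm_sq_add_le (v + ξ e) (-ξ e) hq
    rw [add_neg_cancel_right, norm_neg] at h2
    constructor
    · linarith
    · linarith
  have hsub := hasSubgaussianMGF_of_mem_Icc hhm.aemeasurable hI
  have hint : Integrable h ν := Integrable.of_mem_Icc _ _ hhm.aemeasurable hI
  -- By Jensen the mean of `h` is at most the root of that of `h²`, where the cross term `⟨v, ξ⟩`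
  -- integrates to zero. The step costs `c²` under the root instead of `c` outside it, which keeps
  -- the total of order `√n`.
  have hmean : ∫ e, h e ∂ν ≤ √(‖v‖ ^ 2 + (c ^ 2 + q)) := by
    apply Real.le_sqrt_of_sq_le
    have hL2 : MemLp h 2 ν := memLp_of_bounded hI hhm 2
    have h1 : (∫ e, h e ∂ν) ^ 2 ≤ ∫ e, h e ^ 2 ∂ν := by
      have := variance_nonneg h ν
      rw [variance_eq_sub hL2] at this
      simpa using this
    refine h1.trans ?_
    have h2 : ∀ e, h e ^ 2 = ‖v‖ ^ 2 + 2 * inner ℝ v (ξ e) + ‖ξ e‖ ^ 2 + q := by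
      intro e
      rw [hh]
      simp only
      rw [Real.sq_sqrt (by positivity), norm_add_sq_real]
    have i1 : Integrable (fun e => ‖v‖ ^ 2 + 2 * inner ℝ v (ξ e)) ν :=
      (integrable_const _).add ((hξ.const_inner v).const_mul 2)
    calc ∫ e, h e ^ 2 ∂ν ≤ ∫ e, (‖v‖ ^ 2 + 2 * inner ℝ v (ξ e)) + (c ^ 2 + q) ∂ν := by
          refine integral_mono_ae hL2.integrable_sq (i1.add (integrable_const _)) ?_
          filter_upwards [hb] with e he
          rw [h2]
          have : ‖ξ e‖ ^ 2 ≤ c ^ 2 := by gcongr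
          linarith
      _ = ‖v‖ ^ 2 + (c ^ 2 + q) := by
          rw [integral_add i1 (integrable_const _), integral_add (integrable_const _)
            ((hξ.const_inner v).const_mul 2), integral_const_mul, integral_inner hξ, h0]
          simp
  have hexp : Integrable (fun e => Real.exp (t * h e)) ν :=
    integrable_exp_mul_of_mem_Icc hhm.aemeasurable hI
  have hmgf := hsub.mgf_le t
  rw [← ofReal_integral_eq_lintegral_ofReal hexp (ae_of_all _ fun _ => (Real.exp_pos _).le),
    ← ENNReal.ofReal_mul (Real.exp_pos _).le, ← Real.exp_add]
  apply ENNReal.ofReal_le_ofReal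
  have hpar : (((‖(a + c) - (a - c)‖₊ / 2) ^ 2 : NNReal) : ℝ) = c ^ 2 := by
    push_cast
    rw [Real.norm_eq_abs, show a + c - (a - c) = 2 * c by ring, abs_of_nonneg (by positivity)]
    ring
  rw [hpar] at hmgf
  set m := ∫ e, h e ∂ν with hmdef
  have hsplit : ∫ e, Real.exp (t * h e) ∂ν = Real.exp (t * m) * mgf (fun e => h e - m) ν t := by
    rw [mgf, ← integral_const_mul]
    congr 1 with e
    rw [← Real.exp_add]; congr 1; ring
  rw [hsplit]
  calc Real.exp (t * m) * mgf (fun e => h e - m) ν t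
      ≤ Real.exp (t * √(‖v‖ ^ 2 + (c ^ 2 + q))) * Real.exp (c ^ 2 * t ^ 2 / 2) := by
        gcongr
        exact mgf_nonneg
    _ = _ := by rw [← Real.exp_add]; congr 1; ring

variable {H : Type*} [NormedAddCommGroup H] [NormedSpace ℝ H]

/-- Expected value of `∑_{i ≤ r} f (Z i)` for the autoregression `Z (i + 1) = ρ (Z i) + e` with
innovation law `ν`, started at `x`. -/
noncomputable def expectedSum [MeasurableSpace H] (f : H → K) (ρ : H →L[ℝ] H) (ν : Measure H) :
    ℕ → H → K
  | 0, x => f x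
  | r + 1, x => f x + ∫ e, expectedSum f ρ ν r (ρ x + e) ∂ν

section ExpectedSum

theorem continuous_of_norm_sub_le {E F : Type*} [SeminormedAddCommGroup E]
    [SeminormedAddCommGroup F] {g : E → F} {l : ℝ}
    (h : ∀ x y, ‖g x - g y‖ ≤ l * ‖x - y‖) : Continuous g :=
  (LipschitzWith.of_dist_le' (K := l) fun x y => by
    simpa [dist_eq_norm] using h x y).continuous

theorem integrable_comp_add_of_lipschitz {H K : Type*} [NormedAddCommGroup H]
    [NormedAddCommGroup K] [MeasurableSpace H] [BorelSpace H] [SecondCountableTopology H]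
    {ν : Measure H} [IsProbabilityMeasure ν] {g : H → K} {B l : ℝ} (hB : ∀ x, ‖g x‖ ≤ B)
    (hl : ∀ x y, ‖g x - g y‖ ≤ l * ‖x - y‖) (x : H) : Integrable (fun e => g (x + e)) ν := by
  have hc : Continuous fun e => g (x + e) :=
    (continuous_of_norm_sub_le hl).comp (continuous_const.add continuous_id)
  exact Integrable.of_bound hc.stronglyMeasurable.aestronglyMeasurable B (ae_of_all _ fun e => hB _)

variable [MeasurableSpace H] {f : H → K} {ρ : H →L[ℝ] H} {ν : Measure H}
  [IsProbabilityMeasure ν] {J l : ℝ}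

theorem norm_expectedSum_le (hJ : ∀ x, ‖f x‖ ≤ J) (r : ℕ) (x : H) :
    ‖expectedSum f ρ ν r x‖ ≤ (r + 1) * J := by
  induction r generalizing x with
  | zero => simpa [expectedSum] using hJ x
  | succ r ih =>
    rw [expectedSum]
    have h1 : ‖∫ e, expectedSum f ρ ν r (ρ x + e) ∂ν‖ ≤ (r + 1) * J := by
      have := norm_integral_le_of_norm_le_const (μ := ν)
        (ae_of_all _ fun e => ih (ρ x + e))
      simpa using this
    have := norm_add_le (f x) (∫ e, expectedSum f ρ ν r (ρ x + e) ∂ν)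
    have := hJ x
    push_cast
    linarith

variable [BorelSpace H] [SecondCountableTopology H]

/-- The constant is the geometric sum `l (1 + ‖ρ‖ + ‖ρ‖² + ⋯)`, a fixed point of `L ↦ l + L ‖ρ‖`,
and so does not depend on the number of terms `r`. -/
theorem norm_expectedSum_sub_le (hρ : ‖ρ‖ < 1) (hJ : ∀ x, ‖f x‖ ≤ J) (hl0 : 0 ≤ l)
    (hl : ∀ x y, ‖f x - f y‖ ≤ l * ‖x - y‖) (r : ℕ) (x y : H) :
    ‖expectedSum f ρ ν r x - expectedSum f ρ ν r y‖ ≤ l / (1 - ‖ρ‖) * ‖x - y‖ := by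
  have h1 : 0 < 1 - ‖ρ‖ := by linarith
  have hle : l ≤ l / (1 - ‖ρ‖) := by
    rw [le_div_iff₀ h1]
    nlinarith [norm_nonneg ρ]
  induction r generalizing x y with
  | zero =>
    refine (hl x y).trans ?_
    gcongr
  | succ r ih =>
    rw [expectedSum, expectedSum, add_sub_add_comm, ← integral_sub
      (integrable_comp_add_of_lipschitz (norm_expectedSum_le hJ r) ih _)
      (integrable_comp_add_of_lipschitz (norm_expectedSum_le hJ r) ih _)]
    have h2 : ‖∫ e, expectedSum f ρ ν r (ρ x + e) - expectedSum f ρ ν r (ρ y + e) ∂ν‖ ≤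
        l / (1 - ‖ρ‖) * (‖ρ‖ * ‖x - y‖) := by
      have := norm_integral_le_of_norm_le_const (μ := ν) (C := l / (1 - ‖ρ‖) * (‖ρ‖ * ‖x - y‖))
        (f := fun e => expectedSum f ρ ν r (ρ x + e) - expectedSum f ρ ν r (ρ y + e))
        (ae_of_all _ fun e => by
          refine (ih _ _).trans ?_
          rw [add_sub_add_right_eq_sub, ← map_sub]
          gcongr
          exact ρ.le_opNorm _)
      simpa using this
    calc _ ≤ l * ‖x - y‖ + l / (1 - ‖ρ‖) * (‖ρ‖ * ‖x - y‖) :=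
          (norm_add_le _ _).trans (add_le_add (hl x y) h2)
      _ = _ := by field_simp; ring

end ExpectedSum

section Step

variable [MeasurableSpace H] [BorelSpace H] [SecondCountableTopology H] [CompleteSpace K]
  {f : H → K} {ρ : H →L[ℝ] H} {ν : Measure H} [IsProbabilityMeasure ν] {J l R : ℝ}

/-- One step of the Doob martingale with the state `x` frozen. Two innovations differ by at most
`2R`, so the increment is at most `c`. The offset `r * c ^ 2` under the root is the budget for the
`r` steps still to come. -/
theorem lintegral_exp_expectedSum_le (hρ : ‖ρ‖ < 1) (hJ : ∀ x, ‖f x‖ ≤ J) (hl0 : 0 ≤ l)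
    (hl : ∀ x y, ‖f x - f y‖ ≤ l * ‖x - y‖) (hR : 0 ≤ R) (hν : ∀ᵐ e ∂ν, ‖e‖ ≤ R) {c : ℝ}
    (hc : c = l / (1 - ‖ρ‖) * (2 * R)) (r : ℕ) (s : K) (x : H) {t : ℝ} (ht : 0 ≤ t) :
    ∫⁻ e, ENNReal.ofReal (Real.exp (t *
        √(‖s + f x + expectedSum f ρ ν r (ρ x + e)‖ ^ 2 + r * c ^ 2))) ∂ν ≤
      ENNReal.ofReal (Real.exp (t ^ 2 * c ^ 2 / 2)) * ENNReal.ofReal (Real.exp (t *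
        √(‖s + expectedSum f ρ ν (r + 1) x‖ ^ 2 + ((r + 1 : ℕ) : ℝ) * c ^ 2))) := by
  have h1 : 0 < 1 - ‖ρ‖ := by linarith
  have hc0 : 0 ≤ c := by rw [hc]; positivity
  set g : H → K := fun e => expectedSum f ρ ν r (ρ x + e) with hg
  have hgi : Integrable g ν := integrable_comp_add_of_lipschitz (norm_expectedSum_le hJ r)
    (norm_expectedSum_sub_le hρ hJ hl0 hl r) _
  have hgb : ∀ᵐ e ∂ν, ‖g e - ∫ e', g e' ∂ν‖ ≤ c := by
    filter_upwards [hν] with e he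
    have h2 : g e - ∫ e', g e' ∂ν = ∫ e', (g e - g e') ∂ν := by
      rw [integral_sub (integrable_const _) hgi]; simp
    rw [h2]
    have := norm_integral_le_of_norm_le_const (μ := ν) (f := fun e' => g e - g e') (C := c) (by
      filter_upwards [hν] with e' he'
      refine (norm_expectedSum_sub_le hρ hJ hl0 hl r _ _).trans ?_
      rw [hc, add_sub_add_left_eq_sub]
      gcongr
      refine (norm_sub_le _ _).trans ?_
      linarith)
    simpa using this
  have key := lintegral_exp_sqrt_le (ξ := fun e => g e - ∫ e', g e' ∂ν)
    (hgi.aestronglyMeasurable.sub aestronglyMeasurable_const) hc0 hgb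
    (by rw [integral_sub hgi (integrable_const _)]; simp)
    (s + expectedSum f ρ ν (r + 1) x) (q := r * c ^ 2) (by positivity) ht
  have e1 : ∀ e, s + expectedSum f ρ ν (r + 1) x + (g e - ∫ e', g e' ∂ν) =
      s + f x + expectedSum f ρ ν r (ρ x + e) := by
    intro e
    rw [expectedSum]
    simp only [hg]
    abel
  have e2 : c ^ 2 + r * c ^ 2 = ((r + 1 : ℕ) : ℝ) * c ^ 2 := by push_cast; ring
  simp only [e1] at key
  rwa [e2] at key

variable [MeasurableSpace K] [BorelSpace K]
  {Ω : Type*} [MeasurableSpace Ω] {P : Measure Ω} [IsProbabilityMeasure P]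

/-- The new innovation is independent of the past sum and the current state, so Fubini reduces to
the frozen-state bound. -/
theorem lintegral_exp_step_le (hρ : ‖ρ‖ < 1) (hJ : ∀ x, ‖f x‖ ≤ J) (hl0 : 0 ≤ l)
    (hl : ∀ x y, ‖f x - f y‖ ≤ l * ‖x - y‖) (hR : 0 ≤ R) (hν : ∀ᵐ e ∂ν, ‖e‖ ≤ R) {c : ℝ}
    (hc : c = l / (1 - ‖ρ‖) * (2 * R)) (r : ℕ) {S : Ω → K} {X ε : Ω → H} (hS : Measurable S)
    (hX : Measurable X) (hε : Measurable ε) (hlaw : P.map ε = ν)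
    (hind : IndepFun (fun ω => (S ω, X ω)) ε P) {t : ℝ} (ht : 0 ≤ t) :
    ∫⁻ ω, ENNReal.ofReal (Real.exp (t *
        √(‖S ω + f (X ω) + expectedSum f ρ ν r (ρ (X ω) + ε ω)‖ ^ 2 + r * c ^ 2))) ∂P ≤
      ENNReal.ofReal (Real.exp (t ^ 2 * c ^ 2 / 2)) * ∫⁻ ω, ENNReal.ofReal (Real.exp (t *
        √(‖S ω + expectedSum f ρ ν (r + 1) (X ω)‖ ^ 2 + ((r + 1 : ℕ) : ℝ) * c ^ 2))) ∂P := by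
  have hfc : Continuous f := continuous_of_norm_sub_le hl
  have hec : ∀ r, Continuous (expectedSum f ρ ν r) := fun r =>
    continuous_of_norm_sub_le (norm_expectedSum_sub_le hρ hJ hl0 hl r)
  let Φ : (K × H) × H → ℝ≥0∞ := fun z => ENNReal.ofReal (Real.exp (t *
    √(‖z.1.1 + f z.1.2 + expectedSum f ρ ν r (ρ z.1.2 + z.2)‖ ^ 2 + r * c ^ 2)))
  have hΦ : Measurable Φ := by
    have := hec r
    exact (ENNReal.continuous_ofReal.comp (by fun_prop)).measurable
  have hU : Measurable fun ω => (S ω, X ω) := hS.prodMk hX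
  have hmap := (indepFun_iff_map_prod_eq_prod_map_map hU.aemeasurable hε.aemeasurable).1 hind
  rw [hlaw] at hmap
  calc _ = ∫⁻ ω, Φ ((S ω, X ω), ε ω) ∂P := rfl
    _ = ∫⁻ z, Φ z ∂(P.map fun ω => ((S ω, X ω), ε ω)) :=
        (lintegral_map hΦ (hU.prodMk hε)).symm
    _ = ∫⁻ u, ∫⁻ e, Φ (u, e) ∂ν ∂(P.map fun ω => (S ω, X ω)) := by
        rw [hmap, lintegral_prod _ hΦ.aemeasurable]
    _ = ∫⁻ ω, ∫⁻ e, Φ ((S ω, X ω), e) ∂ν ∂P :=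
        lintegral_map hΦ.lintegral_prod_right' hU
    _ ≤ ∫⁻ ω, ENNReal.ofReal (Real.exp (t ^ 2 * c ^ 2 / 2)) * ENNReal.ofReal (Real.exp (t *
        √(‖S ω + expectedSum f ρ ν (r + 1) (X ω)‖ ^ 2 + ((r + 1 : ℕ) : ℝ) * c ^ 2))) ∂P :=
        lintegral_mono fun ω => lintegral_exp_expectedSum_le hρ hJ hl0 hl hR hν hc r _ _ ht
    _ = _ := lintegral_const_mul' _ _ ENNReal.ofReal_ne_top

variable [SecondCountableTopology K]

/-- Exponential moments of the sum of a bounded Lipschitz functional along an autoregression with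
bounded independent innovations. -/
theorem lintegral_exp_sum_le (hρ : ‖ρ‖ < 1) (hJ : ∀ x, ‖f x‖ ≤ J) (hl0 : 0 ≤ l)
    (hl : ∀ x y, ‖f x - f y‖ ≤ l * ‖x - y‖) (hR : 0 ≤ R) (hν : ∀ᵐ e ∂ν, ‖e‖ ≤ R) {c : ℝ}
    (hc : c = l / (1 - ‖ρ‖) * (2 * R)) {X ε : ℕ → Ω → H}
    (hX : ∀ i, Measurable (X i)) (hε : ∀ i, Measurable (ε i)) (hlaw : ∀ i, P.map (ε i) = ν)
    (hrec : ∀ i, ∀ᵐ ω ∂P, X (i + 1) ω = ρ (X i ω) + ε (i + 1) ω)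
    (hind : ∀ i, IndepFun (fun ω => (∑ k ∈ Finset.range i, f (X k ω), X i ω)) (ε (i + 1)) P)
    (a : K) (N : ℕ) {t : ℝ} (ht : 0 ≤ t) :
    ∫⁻ ω, ENNReal.ofReal (Real.exp (t * ‖∑ k ∈ Finset.range (N + 1), f (X k ω) - a‖)) ∂P ≤
      ENNReal.ofReal (Real.exp (N * (t ^ 2 * c ^ 2 / 2))) * ∫⁻ ω, ENNReal.ofReal (Real.exp (t *
        √(‖expectedSum f ρ ν N (X 0 ω) - a‖ ^ 2 + N * c ^ 2))) ∂P := by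
  have hfm : Measurable f := (continuous_of_norm_sub_le hl).measurable
  -- The vector inside the norm is the conditional expectation of the full sum at time `i`, minus
  -- `a`. Each step yields one factor `exp (t² c² / 2)` and uses up one `c²` of the budget; at `i =
  -- N` the budget is zero and the root is the norm of the full sum.
  have key : ∀ i ≤ N, ∫⁻ ω, ENNReal.ofReal (Real.exp (t *
      √(‖∑ k ∈ Finset.range i, f (X k ω) - a + expectedSum f ρ ν (N - i) (X i ω)‖ ^ 2 +
        ((N - i : ℕ) : ℝ) * c ^ 2))) ∂P ≤
      ENNReal.ofReal (Real.exp (i * (t ^ 2 * c ^ 2 / 2))) * ∫⁻ ω, ENNReal.ofReal (Real.exp (t *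
        √(‖expectedSum f ρ ν N (X 0 ω) - a‖ ^ 2 + N * c ^ 2))) ∂P := by
    intro i hi
    induction i with
    | zero => simp [neg_add_eq_sub]
    | succ i ih =>
      obtain ⟨r, rfl⟩ : ∃ r, N = i + 1 + r := ⟨N - (i + 1), by omega⟩
      have e1 : i + 1 + r - (i + 1) = r := by omega
      have e2 : i + 1 + r - i = r + 1 := by omega
      have ih' := ih (by omega)
      rw [e2] at ih'
      rw [e1]
      have hSm : Measurable fun ω => ∑ k ∈ Finset.range i, f (X k ω) - a :=
        (Finset.measurable_fun_sum _ fun k _ => hfm.comp (hX k)).sub_const a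
      have hind' : IndepFun (fun ω => (∑ k ∈ Finset.range i, f (X k ω) - a, X i ω)) (ε (i + 1)) P :=
        (hind i).comp (φ := fun z : K × H => (z.1 - a, z.2)) (ψ := id) (by fun_prop) measurable_id
      have hstep := lintegral_exp_step_le hρ hJ hl0 hl hR hν hc r hSm (hX i) (hε (i + 1))
        (hlaw (i + 1)) hind' ht
      calc _ = ∫⁻ ω, ENNReal.ofReal (Real.exp (t * √(‖∑ k ∈ Finset.range i, f (X k ω) - a +
              f (X i ω) + expectedSum f ρ ν r (ρ (X i ω) + ε (i + 1) ω)‖ ^ 2 + r * c ^ 2))) ∂P := by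
            refine lintegral_congr_ae ?_
            filter_upwards [hrec i] with ω hω
            rw [hω, Finset.sum_range_succ, sub_add_eq_add_sub _ a (f (X i ω))]
        _ ≤ _ := hstep
        _ ≤ _ := by
            grw [ih']
            rw [← mul_assoc, ← ENNReal.ofReal_mul (Real.exp_pos _).le, ← Real.exp_add]
            gcongr
            push_cast
            linarith
  have hN := key N le_rfl
  refine le_trans (le_of_eq ?_) hN
  refine lintegral_congr fun ω => ?_
  simp only [Nat.sub_self, expectedSum, Nat.cast_zero, zero_mul, add_zero]
  rw [Real.sqrt_sq (norm_nonneg _), Finset.sum_range_succ, sub_add_eq_add_sub]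

end Step

end Concentration

/-! ### From exponential moments to almost sure rates; truncation. -/

section Rate

theorem sqrt_log_div_mul {n : ℕ} (hn : 3 ≤ n) :
    √(Real.log n / n) * √n = √(Real.log n) ∧ √(Real.log n / n) ^ 2 * n = Real.log n ∧
      √(Real.log n / n) * √(n * Real.log n) = Real.log n ∧ 1 ≤ Real.log n := by
  have hn0 : (0 : ℝ) < n := by positivity
  have hlog : 1 ≤ Real.log n := by
    rw [Real.le_log_iff_exp_le hn0]
    have : (3 : ℝ) ≤ n := by exact_mod_cast hn
    linarith [Real.exp_one_lt_d9]
  have hl0 : 0 ≤ Real.log n := by linarith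
  refine ⟨?_, ?_, ?_, hlog⟩
  · rw [← Real.sqrt_mul (by positivity), div_mul_cancel₀ _ hn0.ne']
  · rw [Real.sq_sqrt (by positivity), div_mul_cancel₀ _ hn0.ne']
  · rw [← Real.sqrt_mul (by positivity), show Real.log n / n * (n * Real.log n) = Real.log n ^ 2 by
      field_simp, Real.sqrt_sq hl0]

variable {Ω K : Type*} [MeasurableSpace Ω] {P : Measure Ω}
  [NormedAddCommGroup K] [NormedSpace ℝ K]

/-- Sub-Gaussian exponential moments of order `n` imply the almost sure rate `√(n log n)`. -/
theorem ae_eventually_norm_sub_integral_le {W : ℕ → Ω → K}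
    (hW : ∀ n, AEMeasurable (fun ω => ‖W n ω‖) P) {A : ℝ} (hA : 0 ≤ A)
    (hexp : ∀ n : ℕ, 1 ≤ n → ∀ t : ℝ, 0 ≤ t →
      ∫⁻ ω, ENNReal.ofReal (Real.exp (t * ‖W n ω‖)) ∂P ≤
        ENNReal.ofReal (Real.exp (A * (t * √n + t ^ 2 * n)))) :
    ∃ B : ℝ, ∀ᵐ ω ∂P, ∀ᶠ n : ℕ in atTop, ‖W n ω - ∫ ω', W n ω' ∂P‖ ≤ B * √(n * Real.log n) := by
  have hmean : ∀ n : ℕ, 3 ≤ n → ‖∫ ω', W n ω' ∂P‖ ≤ Real.exp (2 * A) * √(n * Real.log n) := by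
    intro n hn
    have hn0 : (0 : ℝ) < n := by positivity
    obtain ⟨-, -, -, hlog⟩ := sqrt_log_div_mul hn
    have hs : 0 < √(n : ℝ) := Real.sqrt_pos.2 hn0
    -- Taking `t = 1 / √n` makes the exponent `2A`, and `y ≤ √n exp (y / √n)`.
    have h1 : ∫⁻ ω, ENNReal.ofReal ‖W n ω‖ ∂P ≤ ENNReal.ofReal (√n * Real.exp (2 * A)) := by
      calc ∫⁻ ω, ENNReal.ofReal ‖W n ω‖ ∂P
          ≤ ∫⁻ ω, ENNReal.ofReal (√n) * ENNReal.ofReal (Real.exp ((√n)⁻¹ * ‖W n ω‖)) ∂P := by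
            refine lintegral_mono fun ω => ?_
            rw [← ENNReal.ofReal_mul hs.le]
            apply ENNReal.ofReal_le_ofReal
            have h2 := Real.add_one_le_exp ((√n)⁻¹ * ‖W n ω‖)
            calc ‖W n ω‖ = √n * ((√n)⁻¹ * ‖W n ω‖) := by field_simp
              _ ≤ _ := by gcongr; linarith
        _ = ENNReal.ofReal (√n) * ∫⁻ ω, ENNReal.ofReal (Real.exp ((√n)⁻¹ * ‖W n ω‖)) ∂P :=
            lintegral_const_mul' _ _ ENNReal.ofReal_ne_top
        _ ≤ ENNReal.ofReal (√n) * ENNReal.ofReal (Real.exp (2 * A)) := by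
            gcongr
            refine (hexp n (by omega) _ (by positivity)).trans_eq ?_
            congr 2
            rw [inv_mul_cancel₀ hs.ne', inv_pow, Real.sq_sqrt hn0.le, inv_mul_cancel₀ hn0.ne']
            ring
        _ = _ := (ENNReal.ofReal_mul hs.le).symm
    have h3 := norm_integral_le_lintegral_norm (μ := P) (W n)
    have h4 := ENNReal.toReal_mono ENNReal.ofReal_ne_top h1
    rw [ENNReal.toReal_ofReal (by positivity)] at h4
    refine (h3.trans h4).trans ?_
    rw [mul_comm]
    gcongr
    nlinarith
  have htail : ∀ n : ℕ, 3 ≤ n →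
      P {ω | (2 * A + 2) * √(n * Real.log n) ≤ ‖W n ω‖} ≤ ENNReal.ofReal (1 / (n : ℝ) ^ 2) := by
    intro n hn
    have hn0 : (0 : ℝ) < n := by positivity
    obtain ⟨h1, h2, h3, hlog⟩ := sqrt_log_div_mul hn
    -- With this `t` the exponential moment is at most `n ^ (2A)` and the threshold contributes `n ^
    -- (2A + 2)`, leaving the summable tail `n ^ (-2)`.
    set t := √(Real.log n / n) with ht
    have ht0 : 0 < t := Real.sqrt_pos.2 (by positivity)
    have hm : AEMeasurable (fun ω => ENNReal.ofReal (Real.exp (t * ‖W n ω‖))) P :=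
      ((hW n).const_mul t).exp.ennreal_ofReal
    have hmarkov := meas_ge_le_lintegral_div hm
      (ε := ENNReal.ofReal (Real.exp ((2 * A + 2) * Real.log n)))
      (by simp [Real.exp_pos]) ENNReal.ofReal_ne_top
    calc P {ω | (2 * A + 2) * √(n * Real.log n) ≤ ‖W n ω‖}
        ≤ P {ω | ENNReal.ofReal (Real.exp ((2 * A + 2) * Real.log n)) ≤
            ENNReal.ofReal (Real.exp (t * ‖W n ω‖))} := by
          refine measure_mono fun ω hω => ?_
          apply ENNReal.ofReal_le_ofReal
          rw [Real.exp_le_exp]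
          calc (2 * A + 2) * Real.log n = t * ((2 * A + 2) * √(n * Real.log n)) := by
                rw [mul_left_comm, h3]
            _ ≤ _ := by gcongr; exact hω
      _ ≤ _ := hmarkov
      _ ≤ ENNReal.ofReal (Real.exp (2 * A * Real.log n)) /
            ENNReal.ofReal (Real.exp ((2 * A + 2) * Real.log n)) := by
          gcongr
          refine (hexp n (by omega) t ht0.le).trans ?_
          apply ENNReal.ofReal_le_ofReal
          rw [Real.exp_le_exp, h1, h2]
          have : √(Real.log n) ≤ Real.log n := by
            rw [Real.sqrt_le_left (by linarith)]; nlinarith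
          nlinarith
      _ = _ := by
          rw [← ENNReal.ofReal_div_of_pos (Real.exp_pos _), ← Real.exp_sub]
          congr 1
          rw [show 2 * A * Real.log n - (2 * A + 2) * Real.log n = -(Real.log n * (2 : ℕ)) by
            push_cast; ring, Real.exp_neg, Real.exp_mul, Real.exp_log hn0, Real.rpow_natCast,
            one_div]
  have hsum : ∑' n : ℕ, P {ω | 3 ≤ n ∧ (2 * A + 2) * √(n * Real.log n) ≤ ‖W n ω‖} ≠ ∞ := by
    have h5 : Summable fun n : ℕ => 1 / (n : ℝ) ^ 2 :=
      Real.summable_one_div_nat_pow.2 one_lt_two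
    refine ne_top_of_le_ne_top h5.tsum_ofReal_ne_top (ENNReal.tsum_le_tsum fun n => ?_)
    by_cases hn : 3 ≤ n
    · simpa [hn] using htail n hn
    · simp [hn]
  refine ⟨2 * A + 2 + Real.exp (2 * A), ?_⟩
  filter_upwards [ae_eventually_notMem hsum] with ω hω
  filter_upwards [hω, eventually_ge_atTop 3] with n hn hn3
  simp only [hn3, true_and, not_le] at hn
  have := norm_sub_le (W n ω) (∫ ω', W n ω' ∂P)
  have := hmean n hn3
  linarith

variable {H : Type*} [NormedAddCommGroup H] [NormedSpace ℝ H]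

/-- Radial retraction onto the ball of radius `M`. -/
noncomputable def truncate (M : ℝ) (x : H) : H := (M / max M ‖x‖) • x

theorem truncate_of_norm_le {M : ℝ} (hM : 0 < M) {x : H} (hx : ‖x‖ ≤ M) : truncate M x = x := by
  rw [truncate, max_eq_left hx, div_self hM.ne', one_smul]

theorem norm_truncate_le {M : ℝ} (hM : 0 < M) (x : H) : ‖truncate M x‖ ≤ M := by
  have h : 0 < max M ‖x‖ := lt_max_of_lt_left hM
  rw [truncate, norm_smul, Real.norm_of_nonneg (by positivity), div_mul_eq_mul_div, div_le_iff₀ h]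
  gcongr
  exact le_max_right _ _

theorem norm_truncate_sub_le {M : ℝ} (hM : 0 < M) (x y : H) :
    ‖truncate M x - truncate M y‖ ≤ 2 * ‖x - y‖ := by
  have hx : 0 < max M ‖x‖ := lt_max_of_lt_left hM
  have hy : 0 < max M ‖y‖ := lt_max_of_lt_left hM
  have h1 : truncate M x - truncate M y =
      (M / max M ‖x‖) • (x - y) + (M / max M ‖x‖ - M / max M ‖y‖) • y := by
    rw [truncate, truncate]; module
  have h2 : ‖(M / max M ‖x‖) • (x - y)‖ ≤ ‖x - y‖ := by
    rw [norm_smul, Real.norm_of_nonneg (by positivity)]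
    refine mul_le_of_le_one_left (norm_nonneg _) ?_
    rw [div_le_one hx]; exact le_max_left _ _
  have h3 : ‖(M / max M ‖x‖ - M / max M ‖y‖) • y‖ ≤ ‖x - y‖ := by
    have h4 : M / max M ‖x‖ - M / max M ‖y‖ =
        M / max M ‖x‖ * (max M ‖y‖ - max M ‖x‖) / max M ‖y‖ := by
      field_simp
    have h5 : |max M ‖y‖ - max M ‖x‖| ≤ ‖x - y‖ := by
      rw [max_comm M, max_comm M]
      refine (abs_max_sub_max_le_abs _ _ _).trans ?_
      rw [norm_sub_rev]
      exact abs_norm_sub_norm_le _ _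
    rw [norm_smul, h4, Real.norm_eq_abs, abs_div, abs_mul, abs_of_pos hy,
      abs_of_nonneg (by positivity : 0 ≤ M / max M ‖x‖), div_mul_eq_mul_div, div_le_iff₀ hy]
    have h6 : M / max M ‖x‖ ≤ 1 := by rw [div_le_one hx]; exact le_max_left _ _
    calc M / max M ‖x‖ * |max M ‖y‖ - max M ‖x‖| * ‖y‖ ≤ 1 * ‖x - y‖ * max M ‖y‖ := by
          gcongr; exact le_max_right _ _
      _ = _ := by ring
  rw [h1]
  linarith [norm_add_le ((M / max M ‖x‖) • (x - y)) ((M / max M ‖x‖ - M / max M ‖y‖) • y)]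

end Rate

/-! ### Moving-average representation, adaptedness and boundedness of the process. -/

section Representation

theorem countable_of_orthonormal {H : Type*} [NormedAddCommGroup H] [InnerProductSpace ℝ H]
    [TopologicalSpace.SeparableSpace H] {ι : Type*} {e : ι → H} (he : Orthonormal ℝ e) :
    Countable ι := by
  refine Pairwise.countable_of_isOpen_disjoint (s := fun i => Metric.ball (e i) (1 / 2)) ?_
    (fun i => Metric.isOpen_ball) (fun i => ⟨e i, Metric.mem_ball_self (by norm_num)⟩)
  intro i j hij
  apply Metric.ball_disjoint_ball
  rw [dist_eq_norm]
  have h : ‖e i - e j‖ ^ 2 = 2 := by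
    rw [norm_sub_sq_real, he.1, he.1, he.2 hij]; norm_num
  nlinarith [norm_nonneg (e i - e j)]

variable {Ω H : Type*} [MeasurableSpace Ω] {P : Measure Ω} [IsProbabilityMeasure P]
  [NormedAddCommGroup H] [InnerProductSpace ℝ H] [CompleteSpace H]
  [TopologicalSpace.SeparableSpace H] [MeasurableSpace H] [BorelSpace H]

theorem continuous_tensor_self {H : Type*} [NormedAddCommGroup H] [InnerProductSpace ℝ H] :
    Continuous fun x : H => tensor x x := by
  have : Continuous fun x : H => InnerProductSpace.rankOne ℝ x x :=
    (InnerProductSpace.rankOne ℝ (E := H) (F := H)).continuous.clm_apply continuous_id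
  exact this

theorem inner_tensor_apply {H : Type*} [NormedAddCommGroup H] [InnerProductSpace ℝ H]
    (u x y : H) : inner ℝ (tensor u u x) y = (inner ℝ u x * inner ℝ u y : ℝ) := by
  rw [tensor, InnerProductSpace.rankOne_apply, real_inner_smul_left]

theorem inner_covOp_apply {U : Ω → H} (hU : MemLp U 2 P) (hm : Measurable U) (x y : H) :
    inner ℝ (covOp P U U x) y = (∫ ω, inner ℝ (U ω) x * inner ℝ (U ω) y ∂P : ℝ) := by
  have hint : Integrable (fun ω => tensor (U ω) (U ω)) P := by
    refine Integrable.mono' hU.integrable_norm_pow' ?_ (ae_of_all _ fun ω => ?_)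
    · have : SecondCountableTopology H := UniformSpace.secondCountable_of_separable H
      exact continuous_tensor_self.comp_aestronglyMeasurable hm.aestronglyMeasurable
    · simp [tensor, sq]
  rw [covOp, ContinuousLinearMap.integral_apply hint, real_inner_comm,
    ← integral_inner (hint.apply_continuousLinearMap x)]
  congr 1 with ω
  rw [real_inner_comm, inner_tensor_apply]

/-- `E‖X_n‖²` is the trace of the covariance operator, which is shift-invariant. Stationarity is
only of second order here, so equality of laws is not available. -/
theorem IsCentredStationary.lintegral_norm_sq {X : ℤ → Ω → H} (h : IsCentredStationary P X)
    (n : ℤ) : ∫⁻ ω, ENNReal.ofReal (‖X n ω‖ ^ 2) ∂P = ∫⁻ ω, ENNReal.ofReal (‖X 0 ω‖ ^ 2) ∂P := by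
  obtain ⟨w, b, -⟩ := exists_hilbertBasis ℝ H
  have : Countable w := countable_of_orthonormal b.orthonormal
  have key : ∀ m, ∫⁻ ω, ENNReal.ofReal (‖X m ω‖ ^ 2) ∂P =
      ∑' i, ENNReal.ofReal (inner ℝ (covOp P (X m) (X m) (b i)) (b i)) := by
    intro m
    have h1 : ∀ ω, ENNReal.ofReal (‖X m ω‖ ^ 2) =
        ∑' i, ENNReal.ofReal (inner ℝ (X m ω) (b i) ^ 2) := by
      intro ω
      have h2 : HasSum (fun i => inner ℝ (X m ω) (b i) ^ 2) (‖X m ω‖ ^ 2) := by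
        rw [← real_inner_self_eq_norm_sq]
        have h3 : (fun i => inner ℝ (X m ω) (b i) ^ 2) =
            fun i => (inner ℝ (X m ω) (b i) * inner ℝ (b i) (X m ω) : ℝ) := by
          funext i
          rw [real_inner_comm (X m ω) (b i), sq]
        rw [h3]
        exact b.hasSum_inner_mul_inner (X m ω) (X m ω)
      rw [← h2.tsum_eq, ENNReal.ofReal_tsum_of_nonneg (fun i => sq_nonneg _) h2.summable]
    simp_rw [h1]
    have hm : ∀ i, AEMeasurable (fun ω => ENNReal.ofReal (inner ℝ (X m ω) (b i) ^ 2)) P := by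
      intro i
      have := h.measurable m
      fun_prop
    rw [lintegral_tsum hm]
    refine tsum_congr fun i => ?_
    rw [inner_covOp_apply (h.memLp m) (h.measurable m), ofReal_integral_eq_lintegral_ofReal]
    · simp_rw [sq]
    · have := (MemLp.inner_const (h.memLp m) (b i) (𝕜 := ℝ)).integrable_sq
      simpa only [sq] using this
    · exact ae_of_all _ fun ω => mul_self_nonneg _
  have h0 := h.cov_shift 0 0 n
  rw [zero_add] at h0
  rw [key, key, h0]

/-- The `σ`-algebra generated by the innovations up to time `n`. -/
abbrev pastInnov {Ω H : Type*} [MeasurableSpace H] (ε : ℤ → Ω → H) (n : ℤ) : MeasurableSpace Ω :=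
  ⨆ m ∈ Set.Iic n, MeasurableSpace.comap (ε m) inferInstance

theorem pastInnov_mono {Ω H : Type*} [MeasurableSpace H] (ε : ℤ → Ω → H) : Monotone (pastInnov ε) :=
  fun _ _ h => biSup_mono fun _ hm => le_trans hm h

theorem measurable_pastInnov {Ω H : Type*} [MeasurableSpace H] (ε : ℤ → Ω → H) {m n : ℤ} (h : m ≤ n) :
    Measurable[pastInnov ε n] (ε m) := by
  rw [measurable_iff_comap_le]
  exact le_biSup (fun m => MeasurableSpace.comap (ε m) inferInstance) (Set.mem_Iic.2 h)

theorem IsStrongWhiteNoise.indepFun_of_pastInnov {Ω H : Type*} [MeasurableSpace Ω] {P : Measure Ω}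
    [NormedAddCommGroup H] [InnerProductSpace ℝ H] [MeasurableSpace H]
    {ε : ℤ → Ω → H} (h : IsStrongWhiteNoise P ε)
    {n : ℤ} {G : Type*} [MeasurableSpace G] {g : Ω → G} (hg : Measurable[pastInnov ε n] g) :
    IndepFun g (ε (n + 1)) P := by
  have h1 : ProbabilityTheory.iIndep (fun m => MeasurableSpace.comap (ε m) inferInstance) P := h.iIndep
  have h2 := indep_iSup_of_disjoint (fun m => (h.measurable m).comap_le) h1
    (S := Set.Iic n) (T := {n + 1}) (by simp)
  rw [IndepFun_iff_Indep]
  refine indep_of_indep_of_le_left (indep_of_indep_of_le_right h2 ?_) ?_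
  · exact le_biSup (fun m => MeasurableSpace.comap (ε m) inferInstance) (Set.mem_singleton _)
  · exact measurable_iff_comap_le.1 hg

theorem norm_pow_apply_le {E : Type*} [SeminormedAddCommGroup E] [NormedSpace ℝ E]
    (ρ : E →L[ℝ] E) (j : ℕ) (x : E) : ‖(ρ ^ j) x‖ ≤ ‖ρ‖ ^ j * ‖x‖ := by
  induction j generalizing x with
  | zero => simp
  | succ j ih =>
    have h1 : (ρ ^ (j + 1)) x = (ρ ^ j) (ρ x) := by rw [pow_succ]; rfl
    rw [h1, pow_succ, mul_assoc]
    exact (ih _).trans (by gcongr; exact ρ.le_opNorm x)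

theorem measurable_limUnder {α E : Type*} [MeasurableSpace α] [NormedAddCommGroup E]
    [CompleteSpace E] [SecondCountableTopology E] [MeasurableSpace E] [BorelSpace E]
    {f : ℕ → α → E} (hf : ∀ n, Measurable (f n)) :
    Measurable fun x => limUnder atTop fun n => f n x :=
  (StronglyMeasurable.limUnder fun n => (hf n).stronglyMeasurable).measurable

theorem IsARH1.ae_eq_sum {Ω H : Type*} [MeasurableSpace Ω] {P : Measure Ω}
    [NormedAddCommGroup H] [InnerProductSpace ℝ H] [MeasurableSpace H]
    {ρ : H →L[ℝ] H} {ε X : ℤ → Ω → H} (h : IsARH1 P ρ ε X) (n : ℤ) :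
    ∀ᵐ ω ∂P, ∀ N : ℕ, X n ω =
      ∑ j ∈ Finset.range N, (ρ ^ j) (ε (n - j) ω) + (ρ ^ N) (X (n - N) ω) := by
  have hall : ∀ᵐ ω ∂P, ∀ m, X m ω = ρ (X (m - 1) ω) + ε m ω := ae_all_iff.2 h.eqn
  filter_upwards [hall] with ω hω N
  induction N with
  | zero => simp
  | succ N ih =>
    have h1 : ∀ y, (ρ ^ (N + 1)) y = (ρ ^ N) (ρ y) := fun y => by rw [pow_succ]; rfl
    rw [ih, Finset.sum_range_succ, hω (n - N), map_add, h1,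
      show n - ((N + 1 : ℕ) : ℤ) = n - N - 1 by push_cast; ring]
    abel

/-- The remainders `ρ^N X_{n-N}` have second moments at most `‖ρ‖^{2N} E‖X_0‖²`. These are summable,
so the remainders tend to zero almost surely. -/
theorem IsARH1.ae_tendsto_sum {ρ : H →L[ℝ] H} {ε X : ℤ → Ω → H} (h : IsARH1 P ρ ε X) (n : ℤ) :
    ∀ᵐ ω ∂P, Tendsto (fun N : ℕ => ∑ j ∈ Finset.range N, (ρ ^ j) (ε (n - j) ω)) atTop
      (𝓝 (X n ω)) := by
  have hm : ∀ N : ℕ, Measurable fun ω => ENNReal.ofReal (‖(ρ ^ N) (X (n - N) ω)‖ ^ 2) := by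
    intro N
    have := h.stationary.measurable (n - N)
    fun_prop
  set s := ∫⁻ ω, ENNReal.ofReal (‖X 0 ω‖ ^ 2) ∂P with hs
  have hsfin : s ≠ ∞ := by
    have := (h.stationary.memLp 0).integrable_norm_pow'
    exact this.lintegral_lt_top.ne
  have hbound : ∀ N : ℕ, ∫⁻ ω, ENNReal.ofReal (‖(ρ ^ N) (X (n - N) ω)‖ ^ 2) ∂P ≤
      ENNReal.ofReal ((‖ρ‖ ^ 2) ^ N) * s := by
    intro N
    rw [hs, ← h.stationary.lintegral_norm_sq (n - N),
      ← lintegral_const_mul' _ _ ENNReal.ofReal_ne_top]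
    refine lintegral_mono fun ω => ?_
    rw [← ENNReal.ofReal_mul (by positivity)]
    apply ENNReal.ofReal_le_ofReal
    calc _ ≤ (‖ρ‖ ^ N * ‖X (n - N) ω‖) ^ 2 := by gcongr; exact norm_pow_apply_le _ _ _
      _ = _ := by ring
  have hfin : ∫⁻ ω, ∑' N : ℕ, ENNReal.ofReal (‖(ρ ^ N) (X (n - N) ω)‖ ^ 2) ∂P ≠ ∞ := by
    rw [lintegral_tsum fun N => (hm N).aemeasurable]
    refine ne_top_of_le_ne_top ?_ (ENNReal.tsum_le_tsum hbound)
    rw [ENNReal.tsum_mul_right]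
    refine ENNReal.mul_ne_top (Summable.tsum_ofReal_ne_top ?_) hsfin
    refine summable_geometric_of_lt_one (by positivity) ?_
    have := h.norm_lt_one
    nlinarith [norm_nonneg ρ]
  filter_upwards [h.ae_eq_sum n, ae_lt_top' (AEMeasurable.tsum fun N => (hm N).aemeasurable) hfin]
    with ω h1 h2
  have h3 := ENNReal.tendsto_atTop_zero_of_tsum_ne_top h2.ne
  have h4 : Tendsto (fun N : ℕ => ‖(ρ ^ N) (X (n - N) ω)‖ ^ 2) atTop (𝓝 0) := by
    have := (ENNReal.tendsto_toReal ENNReal.zero_ne_top).comp h3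
    simpa [Function.comp_def, ENNReal.toReal_ofReal] using this
  have h5 : Tendsto (fun N : ℕ => (ρ ^ N) (X (n - N) ω)) atTop (𝓝 0) := by
    rw [tendsto_zero_iff_norm_tendsto_zero]
    have := h4.sqrt
    simpa [Real.sqrt_sq] using this
  have h6 : Tendsto (fun N : ℕ => X n ω - (ρ ^ N) (X (n - N) ω)) atTop (𝓝 (X n ω)) := by
    simpa using tendsto_const_nhds.sub h5
  refine h6.congr fun N => ?_
  rw [sub_eq_iff_eq_add]
  exact h1 N

/-- `X n` is only almost surely a function of the past innovations, hence the passage to a version,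
namely the limit of the moving-average series. -/
theorem IsARH1.exists_measurable_pastInnov {ρ : H →L[ℝ] H} {ε X : ℤ → Ω → H}
    (h : IsARH1 P ρ ε X) (n : ℤ) : ∃ Y : Ω → H, Measurable[pastInnov ε n] Y ∧ X n =ᵐ[P] Y := by
  have : SecondCountableTopology H := UniformSpace.secondCountable_of_separable H
  refine ⟨fun ω => limUnder atTop fun N : ℕ => ∑ j ∈ Finset.range N, (ρ ^ j) (ε (n - j) ω), ?_, ?_⟩
  · refine @measurable_limUnder _ _ (pastInnov ε n) _ _ _ _ _ _ fun N => ?_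
    refine Finset.measurable_fun_sum _ fun j _ => ?_
    exact (ρ ^ j).measurable.comp (measurable_pastInnov ε (by omega))
  · filter_upwards [h.ae_tendsto_sum n] with ω hω
    exact hω.limUnder_eq.symm

/-- `X_0` is the sum of the independent variables `ρ X_{-1}` and `ε_0`. By Fubini some fixed `y`
satisfies `‖y + ε_0‖ ≤ M` almost surely, which bounds `ε_0`. -/
theorem IsARH1.exists_ae_norm_innov_le {ρ : H →L[ℝ] H} {ε X : ℤ → Ω → H} (h : IsARH1 P ρ ε X)
    {M : ℝ} (hM : ∀ᵐ ω ∂P, ‖X 0 ω‖ ≤ M) :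
    ∃ R : ℝ, 0 ≤ R ∧ ∀ᵐ x ∂P.map (ε 0), ‖x‖ ≤ R := by
  have : SecondCountableTopology H := UniformSpace.secondCountable_of_separable H
  obtain ⟨Y, hY, hXY⟩ := h.exists_measurable_pastInnov (-1)
  have hind : IndepFun (fun ω => ρ (Y ω)) (ε 0) P :=
    h.noise.indepFun_of_pastInnov (ρ.measurable.comp hY)
  have hind' : IndepFun (fun ω => ρ (X (-1) ω)) (ε 0) P := by
    refine hind.congr ?_ (ae_eq_refl _)
    filter_upwards [hXY] with ω hω
    rw [hω]
  have hmX : Measurable fun ω => ρ (X (-1) ω) := ρ.measurable.comp (h.stationary.measurable (-1))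
  have hmε := h.noise.measurable 0
  have hprod := (indepFun_iff_map_prod_eq_prod_map_map hmX.aemeasurable hmε.aemeasurable).1 hind'
  have hs : MeasurableSet {z : H × H | ‖z.1 + z.2‖ ≤ M} :=
    measurableSet_le (by fun_prop) measurable_const
  have h1 : ∀ᵐ z ∂(P.map fun ω => (ρ (X (-1) ω), ε 0 ω)), ‖z.1 + z.2‖ ≤ M := by
    rw [ae_map_iff (hmX.prodMk hmε).aemeasurable hs]
    filter_upwards [hM, h.eqn 0] with ω h2 h3
    rw [h3] at h2
    exact h2
  rw [hprod] at h1
  have h2 := Measure.ae_ae_of_ae_prod h1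
  have : IsProbabilityMeasure (P.map fun ω => ρ (X (-1) ω)) :=
    Measure.isProbabilityMeasure_map hmX.aemeasurable
  obtain ⟨y, hy⟩ := h2.exists
  refine ⟨|M| + ‖y‖, by positivity, ?_⟩
  filter_upwards [hy] with e he
  have := norm_sub_le (y + e) y
  rw [add_sub_cancel_left] at this
  linarith [le_abs_self M]

/-- Second-order stationarity does not carry the bound on `X_0` to other times; the moving-average
series with bounded innovations does. -/
theorem IsARH1.ae_norm_le {ρ : H →L[ℝ] H} {ε X : ℤ → Ω → H} (h : IsARH1 P ρ ε X)
    {R : ℝ} (hR0 : 0 ≤ R) (hR : ∀ᵐ x ∂P.map (ε 0), ‖x‖ ≤ R) :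
    ∀ᵐ ω ∂P, ∀ n, ‖X n ω‖ ≤ R / (1 - ‖ρ‖) := by
  have hε : ∀ᵐ ω ∂P, ∀ n, ‖ε n ω‖ ≤ R := by
    rw [ae_all_iff]
    intro n
    rw [← (h.noise.identDistrib n).map_eq] at hR
    exact ae_of_ae_map (h.noise.measurable n).aemeasurable hR
  filter_upwards [hε, ae_all_iff.2 h.ae_tendsto_sum] with ω h1 h2 n
  refine le_of_tendsto (h2 n).norm (Eventually.of_forall fun N => ?_)
  have hρ := h.norm_lt_one
  calc ‖∑ j ∈ Finset.range N, (ρ ^ j) (ε (n - j) ω)‖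
      ≤ ∑ j ∈ Finset.range N, ‖ρ‖ ^ j * R := by
        refine norm_sum_le_of_le _ fun j _ => ?_
        refine (norm_pow_apply_le _ _ _).trans ?_
        gcongr
        exact h1 _
    _ = (∑ j ∈ Finset.range N, ‖ρ‖ ^ j) * R := (Finset.sum_mul _ _ _).symm
    _ ≤ (1 - ‖ρ‖)⁻¹ * R := by
        gcongr
        rw [← tsum_geometric_of_lt_one (norm_nonneg _) hρ]
        exact (summable_geometric_of_lt_one (norm_nonneg _) hρ).sum_le_tsum _
          fun i _ => by positivity
    _ = _ := by rw [div_eq_inv_mul]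

end Representation

/-! ### Rate for the empirical autocovariance operator. -/

section Convergence

variable {Ω H : Type*} [MeasurableSpace Ω] {P : Measure Ω} [IsProbabilityMeasure P]
  [NormedAddCommGroup H] [InnerProductSpace ℝ H] [CompleteSpace H]
  [TopologicalSpace.SeparableSpace H] [MeasurableSpace H] [BorelSpace H]

theorem IsARH1.indepFun_sum {K : Type*} [NormedAddCommGroup K] [MeasurableSpace K] [BorelSpace K]
    [SecondCountableTopology K] {ρ : H →L[ℝ] H} {ε X : ℤ → Ω → H} (h : IsARH1 P ρ ε X)
    {f : H → K} (hf : Measurable f) (i : ℕ) :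
    IndepFun (fun ω => (∑ k ∈ Finset.range i, f (X k ω), X i ω)) (ε (i + 1)) P := by
  choose Y hY hXY using h.exists_measurable_pastInnov
  have hm : Measurable[pastInnov ε i] fun ω => (∑ k ∈ Finset.range i, f (Y k ω), Y i ω) := by
    refine Measurable.prodMk (Finset.measurable_fun_sum _ fun k hk => ?_) (hY i)
    have hk' : (k : ℤ) ≤ i := by exact_mod_cast (Finset.mem_range.1 hk).le
    exact hf.comp ((hY k).mono (pastInnov_mono ε hk') le_rfl)
  refine (h.noise.indepFun_of_pastInnov hm).congr ?_ (ae_eq_refl _)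
  filter_upwards [ae_all_iff.2 hXY] with ω hω
  simp [hω]

/-- Almost sure rate of convergence for sums of bounded Lipschitz Hilbert-valued functionals of a
bounded ARH(1) process. -/
theorem IsARH1.ae_eventually_norm_sum_sub_le {K : Type*} [NormedAddCommGroup K]
    [InnerProductSpace ℝ K] [CompleteSpace K] [SecondCountableTopology K] {ρ : H →L[ℝ] H}
    {ε X : ℤ → Ω → H} (h : IsARH1 P ρ ε X) {R : ℝ} (hR0 : 0 ≤ R)
    (hR : ∀ᵐ x ∂P.map (ε 0), ‖x‖ ≤ R) {f : H → K} {J l : ℝ} (hJ : ∀ x, ‖f x‖ ≤ J) (hl0 : 0 ≤ l)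
    (hl : ∀ x y, ‖f x - f y‖ ≤ l * ‖x - y‖) :
    ∃ B : ℝ, ∀ᵐ ω ∂P, ∀ᶠ n : ℕ in atTop,
      ‖∑ k ∈ Finset.range n, f (X k ω) - ∑ k ∈ Finset.range n, ∫ ω', f (X k ω') ∂P‖ ≤
        B * √(n * Real.log n) := by
  borelize K
  have : SecondCountableTopology H := UniformSpace.secondCountable_of_separable H
  set ν := P.map (ε 0) with hν
  have : IsProbabilityMeasure ν :=
    Measure.isProbabilityMeasure_map (h.noise.measurable 0).aemeasurable
  have hfm : Measurable f := (continuous_of_norm_sub_le hl).measurable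
  have hfi : ∀ k : ℕ, Integrable (fun ω => f (X k ω)) P := fun k =>
    Integrable.of_bound (hfm.comp (h.stationary.measurable k)).aestronglyMeasurable J
      (ae_of_all _ fun ω => hJ _)
  have hρ := h.norm_lt_one
  have h1ρ : 0 < 1 - ‖ρ‖ := by linarith
  set c := l / (1 - ‖ρ‖) * (2 * R) with hc
  set d := l / (1 - ‖ρ‖) * (R / (1 - ‖ρ‖)) with hd
  have hc0 : 0 ≤ c := by positivity
  have hd0 : 0 ≤ d := by positivity
  -- A deterministic centre: the expected sum for a start at the origin. It differs from the
  -- conditional expectation given `X 0` by at most `d`, by the Lipschitz bound; recentring at the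
  -- true mean is left to `ae_eventually_norm_sub_integral_le`.
  let a : ℕ → K := fun n => expectedSum f ρ ν (n - 1) 0
  let W : ℕ → Ω → K := fun n ω => ∑ k ∈ Finset.range n, f (X k ω) - a n
  have hWi : ∀ n, ∫ ω, W n ω ∂P = ∑ k ∈ Finset.range n, ∫ ω', f (X k ω') ∂P - a n := by
    intro n
    rw [integral_sub (integrable_finsetSum _ fun k _ => hfi k) (integrable_const _),
      integral_finsetSum _ fun k _ => hfi k]
    simp
  have hWm : ∀ n, AEMeasurable (fun ω => ‖W n ω‖) P := fun n =>
    ((integrable_finsetSum _ fun k _ => hfi k).aestronglyMeasurable.sub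
      aestronglyMeasurable_const).norm.aemeasurable
  obtain ⟨B, hB⟩ := ae_eventually_norm_sub_integral_le hWm (A := d + c + c ^ 2) (by positivity) (by
    intro n hn t ht
    obtain ⟨N, rfl⟩ : ∃ N, n = N + 1 := ⟨n - 1, by omega⟩
    have hsum := lintegral_exp_sum_le (P := P) hρ hJ hl0 hl hR0 hR hc
      (X := fun i : ℕ => X i) (ε := fun i : ℕ => ε i) (fun i => h.stationary.measurable i)
      (fun i => h.noise.measurable i) (fun i => (h.noise.identDistrib i).map_eq)
      (fun i => by
        have := h.eqn (i + 1)
        simpa using this)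
      (fun i => by
        have := h.indepFun_sum hfm i
        simpa using this)
      (a (N + 1)) N ht
    refine hsum.trans ?_
    have hX0 : ∫⁻ ω, ENNReal.ofReal (Real.exp (t *
        √(‖expectedSum f ρ ν N (X (0 : ℕ) ω) - a (N + 1)‖ ^ 2 + N * c ^ 2))) ∂P ≤
        ENNReal.ofReal (Real.exp (t * ((d + c) * √((N + 1 : ℕ) : ℝ)))) := by
      calc _ ≤ ∫⁻ ω, ENNReal.ofReal (Real.exp (t * ((d + c) * √((N + 1 : ℕ) : ℝ)))) ∂P := by
            refine lintegral_mono_ae ?_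
            filter_upwards [h.ae_norm_le hR0 hR] with ω hω
            gcongr
            rw [Real.sqrt_le_left (by positivity), mul_pow (d + c), Real.sq_sqrt (by positivity)]
            have h2 : ‖expectedSum f ρ ν N (X (0 : ℕ) ω) - a (N + 1)‖ ≤ d := by
              refine (norm_expectedSum_sub_le hρ hJ hl0 hl N _ _).trans ?_
              rw [sub_zero, hd]
              gcongr
              exact hω _
            have h3 : ‖expectedSum f ρ ν N (X (0 : ℕ) ω) - a (N + 1)‖ ^ 2 ≤ d ^ 2 := by gcongr
            push_cast at h3 ⊢
            have : (0 : ℝ) ≤ N := by positivity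
            nlinarith [mul_nonneg hd0 hc0, mul_nonneg (mul_nonneg hd0 hc0) this,
              mul_nonneg (sq_nonneg d) this, sq_nonneg c]
        _ = _ := by simp
    grw [hX0]
    rw [← ENNReal.ofReal_mul (Real.exp_pos _).le, ← Real.exp_add]
    gcongr
    have e1 : 0 ≤ t * √((N + 1 : ℕ) : ℝ) * c ^ 2 := by positivity
    have e2 : 0 ≤ t ^ 2 * ((N + 1 : ℕ) : ℝ) * (d + c) := by positivity
    have e3 : N * (t ^ 2 * c ^ 2 / 2) ≤ t ^ 2 * ((N + 1 : ℕ) : ℝ) * c ^ 2 := by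
      push_cast
      nlinarith [sq_nonneg (t * c), mul_nonneg (Nat.cast_nonneg (α := ℝ) N) (sq_nonneg (t * c))]
    linarith)
  refine ⟨B, ?_⟩
  filter_upwards [hB] with ω hω
  filter_upwards [hω] with n hn
  rw [hWi] at hn
  simpa [W] using hn

open TensorProduct in
/-- The tensor square of a vector in the completed Hilbert tensor square. -/
noncomputable def tensorSq {H : Type*} [NormedAddCommGroup H] [InnerProductSpace ℝ H] (x : H) :
    UniformSpace.Completion (H ⊗[ℝ] H) :=
  ((x ⊗ₜ[ℝ] x : H ⊗[ℝ] H) : UniformSpace.Completion (H ⊗[ℝ] H))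

open TensorProduct in
theorem norm_tensorSq_sub_le {H : Type*} [NormedAddCommGroup H] [InnerProductSpace ℝ H] {M : ℝ}
    {x y : H} (hx : ‖x‖ ≤ M) (hy : ‖y‖ ≤ M) :
    ‖tensorSq x - tensorSq y‖ ≤ 2 * M * ‖x - y‖ := by
  have h1 : x ⊗ₜ[ℝ] x - y ⊗ₜ[ℝ] y = x ⊗ₜ[ℝ] (x - y) + (x - y) ⊗ₜ[ℝ] y := by
    rw [tmul_sub, sub_tmul]; abel
  rw [tensorSq, tensorSq, ← UniformSpace.Completion.coe_sub, UniformSpace.Completion.norm_coe, h1]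
  refine (norm_add_le _ _).trans ?_
  rw [norm_tmul, norm_tmul]
  nlinarith [norm_nonneg (x - y)]

open TensorProduct in
theorem separableSpace_tensorProduct {H : Type*} [NormedAddCommGroup H] [InnerProductSpace ℝ H]
    [TopologicalSpace.SeparableSpace H] : TopologicalSpace.SeparableSpace (H ⊗[ℝ] H) := by
  have h1 : TopologicalSpace.IsSeparable (Set.range fun z : H × H => z.1 ⊗ₜ[ℝ] z.2) :=
    TopologicalSpace.isSeparable_range continuous_tmul
  have h2 := h1.span (R := ℝ)
  have h3 : Submodule.span ℝ (Set.range fun z : H × H => z.1 ⊗ₜ[ℝ] z.2) = ⊤ := by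
    rw [← span_tmul_eq_top]
    congr 1
    ext t
    simp
  rw [h3] at h2
  exact TopologicalSpace.isSeparable_univ_iff.1 h2

theorem inner_empCov_apply {Ω H : Type*} [NormedAddCommGroup H] [InnerProductSpace ℝ H]
    (X : ℤ → Ω → H) (n : ℕ) (ω : Ω) (x y : H) : inner ℝ (empCov X n ω x) y =
      ((n : ℝ)⁻¹ * ∑ i ∈ Finset.range n, inner ℝ (X i ω) x * inner ℝ (X i ω) y : ℝ) := by
  simp [empCov, sum_inner, inner_tensor_apply, real_inner_smul_left]

open TensorProduct in
/-- Almost sure rate of convergence of the empirical autocovariance operator of a bounded ARH(1)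
process. -/
theorem IsARH1.ae_eventually_norm_empCov_sub_le {ρ : H →L[ℝ] H} {ε X : ℤ → Ω → H}
    (h : IsARH1 P ρ ε X) (hbdd : ∃ M : ℝ, ∀ᵐ ω ∂P, ‖X 0 ω‖ ≤ M) :
    ∃ B : ℝ, ∀ᵐ ω ∂P, ∀ᶠ n : ℕ in atTop,
      ‖empCov X n ω - autocov P X‖ ≤ B * √(Real.log n / n) := by
  obtain ⟨M₀, hM₀⟩ := hbdd
  obtain ⟨R, hR0, hR⟩ := h.exists_ae_norm_innov_le hM₀
  have hρ := h.norm_lt_one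
  have h1ρ : 0 < 1 - ‖ρ‖ := by linarith
  set M := R / (1 - ‖ρ‖) + 1 with hM
  have hM0 : 0 < M := by positivity
  have hXM : ∀ᵐ ω ∂P, ∀ n, ‖X n ω‖ ≤ M := by
    filter_upwards [h.ae_norm_le hR0 hR] with ω hω n
    linarith [hω n]
  have := separableSpace_tensorProduct (H := H)
  have : SecondCountableTopology (UniformSpace.Completion (H ⊗[ℝ] H)) :=
    UniformSpace.secondCountable_of_separable _
  have : SecondCountableTopology H := UniformSpace.secondCountable_of_separable H
  -- Almost surely every `X n` lies in the ball of radius `M`, where the truncation is the identity,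
  -- so `f (X n)` is the true tensor square.
  let f : H → UniformSpace.Completion (H ⊗[ℝ] H) := fun x => tensorSq (truncate M x)
  have hJ : ∀ x, ‖f x‖ ≤ M * M := by
    intro x
    simp only [f, tensorSq, UniformSpace.Completion.norm_coe, norm_tmul]
    have := norm_truncate_le hM0 x
    gcongr
  have hl : ∀ x y, ‖f x - f y‖ ≤ 4 * M * ‖x - y‖ := by
    intro x y
    refine (norm_tensorSq_sub_le (norm_truncate_le hM0 x) (norm_truncate_le hM0 y)).trans ?_
    nlinarith [norm_truncate_sub_le hM0 x y]
  have hfi : ∀ k : ℕ, Integrable (fun ω => f (X k ω)) P := fun k =>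
    Integrable.of_bound ((continuous_of_norm_sub_le hl).comp_aestronglyMeasurable
      (h.stationary.measurable k).aestronglyMeasurable) (M * M) (ae_of_all _ fun ω => hJ _)
  have hinner : ∀ x u v : H, ‖x‖ ≤ M →
      inner ℝ ((u ⊗ₜ[ℝ] v : H ⊗[ℝ] H) : UniformSpace.Completion (H ⊗[ℝ] H)) (f x) =
        (inner ℝ x u * inner ℝ x v : ℝ) := by
    intro x u v hx
    simp only [f, truncate_of_norm_le hM0 hx, tensorSq, UniformSpace.Completion.inner_coe,
      inner_tmul]
    rw [real_inner_comm x u, real_inner_comm x v]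
  obtain ⟨B, hB⟩ := h.ae_eventually_norm_sum_sub_le hR0 hR hJ (by positivity) hl
  refine ⟨B, ?_⟩
  filter_upwards [hB, hXM] with ω hω hωM
  filter_upwards [hω, eventually_ge_atTop 3] with n hn hn3
  have hn0 : (0 : ℝ) < n := by positivity
  set D := ∑ k ∈ Finset.range n, f (X k ω) - ∑ k ∈ Finset.range n, ∫ ω', f (X k ω') ∂P with hD
  have hDi : ∀ u v : H,
      inner ℝ ((u ⊗ₜ[ℝ] v : H ⊗[ℝ] H) : UniformSpace.Completion (H ⊗[ℝ] H)) D =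
        (n * inner ℝ ((empCov X n ω - autocov P X) u) v : ℝ) := by
    intro u v
    -- Paired with simple tensors, the mean of `f (X k)` depends only on the covariance operator of
    -- `X k`, so second-order stationarity suffices.
    have h1 : ∀ k : ℕ, inner ℝ ((u ⊗ₜ[ℝ] v : H ⊗[ℝ] H) : UniformSpace.Completion (H ⊗[ℝ] H))
        (∫ ω', f (X k ω') ∂P) = (inner ℝ (autocov P X u) v : ℝ) := by
      intro k
      have h0 := h.stationary.cov_shift 0 0 k
      rw [zero_add] at h0
      rw [← integral_inner (hfi k), autocov, ← h0,
        inner_covOp_apply (h.stationary.memLp k) (h.stationary.measurable k)]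
      refine integral_congr_ae ?_
      filter_upwards [hXM] with ω' hω'
      exact hinner _ _ _ (hω' k)
    rw [hD, inner_sub_right, inner_sum, inner_sum, sub_apply, inner_sub_left, inner_empCov_apply]
    simp only [h1, hinner _ _ _ (hωM _), Finset.sum_const, Finset.card_range, nsmul_eq_mul]
    field_simp
  -- The Hilbert–Schmidt norm dominates the operator norm: pair `D` with `u ⊗ v`, where `v` is the
  -- image of `u`.
  have hop : ‖empCov X n ω - autocov P X‖ ≤ ‖D‖ / n := by
    refine ContinuousLinearMap.opNorm_le_bound _ (by positivity) fun u => ?_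
    set v := (empCov X n ω - autocov P X) u with hv
    have h2 := real_inner_le_norm
      ((u ⊗ₜ[ℝ] v : H ⊗[ℝ] H) : UniformSpace.Completion (H ⊗[ℝ] H)) D
    rw [hDi, ← hv, real_inner_self_eq_norm_sq, UniformSpace.Completion.norm_coe, norm_tmul] at h2
    rcases (norm_nonneg v).eq_or_lt with h0 | h0
    · rw [← h0]; positivity
    · rw [div_mul_eq_mul_div, le_div_iff₀ hn0]
      refine le_of_mul_le_mul_right ?_ h0
      linarith
  refine hop.trans ?_
  rw [div_le_iff₀ hn0]
  refine hn.trans_eq ?_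
  have h3 : √(n * Real.log n) = √(Real.log n / n) * n := by
    have h4 : (n : ℝ) * Real.log n = Real.log n / n * n ^ 2 := by field_simp
    rw [h4, Real.sqrt_mul' _ (by positivity), Real.sqrt_sq hn0.le]
  rw [h3]; ring

theorem invGap_pos {c : ℕ → ℝ} {k : ℕ} (hk : 1 ≤ k) : 0 < invGap c k := by
  have h1 : (ENNReal.ofReal (c 0 - c (0 + 1)))⁻¹ ≤ invGap c k :=
    le_iSup (fun j : Fin k => (ENNReal.ofReal (c j - c (j + 1)))⁻¹) ⟨0, hk⟩
  exact lt_of_lt_of_le (by simp) h1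

theorem add_inv_invGap_le {c : ℕ → ℝ} {k : ℕ} (hk : 1 ≤ k) (hfin : invGap c k ≠ ∞) {i : ℕ}
    (hi : i < k) : c (i + 1) + (invGap c k).toReal⁻¹ ≤ c i := by
  have h1 : (ENNReal.ofReal (c i - c (i + 1)))⁻¹ ≤ invGap c k :=
    le_iSup (fun j : Fin k => (ENNReal.ofReal (c j - c (j + 1)))⁻¹) ⟨i, hi⟩
  have h2 : (invGap c k)⁻¹ ≤ ENNReal.ofReal (c i - c (i + 1)) := ENNReal.inv_le_iff_inv_le.1 h1
  have hpos := ENNReal.toReal_pos (invGap_pos (c := c) hk).ne' hfin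
  rcases le_or_gt (c i - c (i + 1)) 0 with h3 | h3
  · rw [ENNReal.ofReal_of_nonpos h3, nonpos_iff_eq_zero, ENNReal.inv_eq_zero] at h2
    exact absurd h2 hfin
  · have h4 := ENNReal.toReal_mono ENNReal.ofReal_ne_top h2
    rw [ENNReal.toReal_inv, ENNReal.toReal_ofReal h3.le] at h4
    linarith

theorem rpow_div_log_rpow_mul_sqrt {n : ℕ} (hn : 3 ≤ n) (β : ℝ) :
    (n : ℝ) ^ (1 / 4 : ℝ) / Real.log n ^ β * √(Real.log n / n) =
      ((n : ℝ) ^ (1 / 4 : ℝ) * Real.log n ^ (β - 1 / 2))⁻¹ := by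
  have hn0 : (0 : ℝ) < n := by positivity
  have hlog : 0 < Real.log n := by linarith [(sqrt_log_div_mul hn).2.2.2]
  rw [Real.sqrt_div hlog.le, Real.sqrt_eq_rpow, Real.sqrt_eq_rpow, mul_inv, ← Real.rpow_neg hn0.le,
    ← Real.rpow_neg hlog.le, div_mul_div_comm, mul_comm (Real.log n ^ β), mul_div_mul_comm,
    ← Real.rpow_sub hn0, ← Real.rpow_sub hlog]
  norm_num

end Convergence

end ARH

/-! ### The main theorem. -/

theorem lemma2
    {Ω : Type*} [MeasurableSpace Ω] (P : Measure Ω) [IsProbabilityMeasure P]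
    {H : Type*} [NormedAddCommGroup H] [InnerProductSpace ℝ H] [CompleteSpace H]
    [TopologicalSpace.SeparableSpace H] [MeasurableSpace H] [BorelSpace H]
    (ρ : H →L[ℝ] H) (ε X : ℤ → Ω → H) (hX : ARH.IsARH1 P ρ ε X)
    -- eigenvalues and eigenvectors of the autocovariance operator
    (C : ℕ → ℝ) (φ : ℕ → H) (hφ : ARH.IsEigensystem (ARH.autocov P X) C φ)
    -- empirical eigenvalues and eigenvectors
    (Cn : ℕ → ℕ → Ω → ℝ) (φn : ℕ → ℕ → Ω → H)
    (hφn : ∀ n, 2 ≤ n → ∀ᵐ ω ∂P,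
      ARH.IsEigensystem (ARH.empCov X n ω) (fun j => Cn n j ω) (fun j => φn n j ω))
    -- truncation parameter
    (k : ℕ → ℕ) (hk : Tendsto k atTop atTop)
    (hk_bd : ∀ n, 2 ≤ n → 1 ≤ k n ∧ (k n : ℝ) / (n : ℝ) < 1)
    -- `X₀` is bounded and has a finite fourth moment
    (hbdd : ∃ M : ℝ, ∀ᵐ ω ∂P, ‖X 0 ω‖ ≤ M)
    (hA1 : Integrable (fun ω => ‖X 0 ω‖ ^ 4) P)
    (β : ℝ) (hβ : 1 / 2 < β)
    -- `Λ_{k_n} = o(n^{1/4} (ln n)^{β - 1/2})`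
    (hΛ : Tendsto (fun n : ℕ => ARH.invGap C (k n) /
      ENNReal.ofReal ((n : ℝ) ^ (1 / 4 : ℝ) * Real.log n ^ (β - 1 / 2))) atTop (𝓝 0)) :
    ∀ᵐ ω ∂P, Tendsto (fun n : ℕ => (n : ℝ) ^ (1 / 4 : ℝ) / Real.log n ^ β *
      ⨆ j : Fin (k n), ‖ARH.signAdjust (φn n j ω) (φ j) - φn n j ω‖) atTop (𝓝 0) := by
  obtain ⟨B, hB⟩ := hX.ae_eventually_norm_empCov_sub_le hbdd
  have hsys : ∀ᵐ ω ∂P, ∀ n, 2 ≤ n →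
      ARH.IsEigensystem (ARH.empCov X n ω) (fun j => Cn n j ω) (fun j => φn n j ω) := by
    rw [ae_all_iff]
    intro n
    by_cases hn : 2 ≤ n
    · filter_upwards [hφn n hn] with ω hω _ using hω
    · exact ae_of_all _ fun ω h => absurd h hn
  have hT : ∀ x y, inner ℝ (ARH.autocov P X x) y =
      (∫ ω, inner ℝ (X 0 ω) x * inner ℝ (X 0 ω) y ∂P : ℝ) :=
    ARH.inner_covOp_apply (hX.stationary.memLp 0) (hX.stationary.measurable 0)
  have hTpos : ∀ x, 0 ≤ (inner ℝ (ARH.autocov P X x) x : ℝ) := fun x => by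
    rw [hT]; exact integral_nonneg fun ω => mul_self_nonneg _
  have hTsymm : ∀ x y, inner ℝ (ARH.autocov P X x) y = (inner ℝ x (ARH.autocov P X y) : ℝ) :=
    fun x y => by
      rw [real_inner_comm (ARH.autocov P X y) x, hT, hT]; simp_rw [mul_comm]
  -- In `[0, ∞]` an infinite `Λ` divided by a finite number is `∞`, so convergence to zero makes
  -- `Λ_{k_n}` eventually finite and the gaps positive.
  have hfin : ∀ᶠ n : ℕ in atTop, ARH.invGap C (k n) ≠ ∞ := by
    filter_upwards [hΛ.eventually_lt_const ENNReal.zero_lt_top] with n hn h0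
    rw [h0, ENNReal.top_div_of_ne_top ENNReal.ofReal_ne_top] at hn
    exact lt_irrefl _ hn
  have hlim : Tendsto (fun n : ℕ => 4 * B * ((ARH.invGap C (k n)).toReal *
      ((n : ℝ) ^ (1 / 4 : ℝ) * Real.log n ^ (β - 1 / 2))⁻¹)) atTop (𝓝 0) := by
    have h1 := ((ENNReal.tendsto_toReal ENNReal.zero_ne_top).comp hΛ).const_mul (4 * B)
    rw [ENNReal.toReal_zero, mul_zero] at h1
    refine h1.congr fun n => ?_
    have hnn : 0 ≤ (n : ℝ) ^ (1 / 4 : ℝ) * Real.log n ^ (β - 1 / 2) :=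
      mul_nonneg (by positivity) (Real.rpow_nonneg (Real.log_natCast_nonneg n) _)
    rw [Function.comp_apply, ENNReal.toReal_div, ENNReal.toReal_ofReal hnn, div_eq_mul_inv]
  filter_upwards [hB, hsys] with ω hω hsysω
  refine squeeze_zero' (Eventually.of_forall fun n => ?_) ?_ hlim
  · exact mul_nonneg (div_nonneg (by positivity)
      (Real.rpow_nonneg (Real.log_natCast_nonneg n) _)) (Real.iSup_nonneg fun _ => norm_nonneg _)
  · filter_upwards [hω, hfin, eventually_ge_atTop 3] with n hn hfin hn3
    have hk1 := (hk_bd n (by omega)).1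
    set Λ := (ARH.invGap C (k n)).toReal with hΛdef
    have hΛ0 : 0 < Λ := ENNReal.toReal_pos (ARH.invGap_pos hk1).ne' hfin
    have hpos : ∀ x, 0 ≤ (inner ℝ (ARH.empCov X n ω x) x : ℝ) := fun x => by
      rw [ARH.inner_empCov_apply]
      exact mul_nonneg (by positivity) (Finset.sum_nonneg fun i _ => mul_self_nonneg _)
    have hsup : (⨆ j : Fin (k n), ‖ARH.signAdjust (φn n j ω) (φ j) - φn n j ω‖) ≤
        4 * (B * √(Real.log n / n)) * Λ := by
      have : Nonempty (Fin (k n)) := ⟨⟨0, hk1⟩⟩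
      refine ciSup_le fun j => ?_
      -- The gap parameter is `Λ⁻¹`. Only the gaps with index `i ≤ j < k n` enter, exactly those
      -- controlled by `invGap C (k n)`.
      have h1 := hφ.norm_signAdjust_sub_le (hsysω n (by omega)) hTpos hpos hTsymm (j := j)
        (inv_pos.2 hΛ0) fun i hi => ARH.add_inv_invGap_le hk1 hfin (lt_of_le_of_lt hi j.2)
      rw [div_inv_eq_mul] at h1
      refine h1.trans ?_
      gcongr
    have hfac : 0 ≤ (n : ℝ) ^ (1 / 4 : ℝ) / Real.log n ^ β :=
      div_nonneg (by positivity) (Real.rpow_nonneg (Real.log_natCast_nonneg n) _)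
    calc _ ≤ (n : ℝ) ^ (1 / 4 : ℝ) / Real.log n ^ β * (4 * (B * √(Real.log n / n)) * Λ) :=
          mul_le_mul_of_nonneg_left hsup hfac
      _ = 4 * B * (Λ * ((n : ℝ) ^ (1 / 4 : ℝ) / Real.log n ^ β * √(Real.log n / n))) := by ring
      _ = _ := by rw [ARH.rpow_div_log_rpow_mul_sqrt hn3]
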